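/- **Lemma (Poisson identities).** Let $a,a^\dagger$ be the annihilation and creation operators of the harmonic oscillator, $[a,a^\dagger]=1$, let $X_\phi=\tfrac12(a^\dagger e^{i\phi}+ae^{-i\phi})$, $\phi\in[0,\pi)$, be the quadratures, and $dE_\phi(x)$ the spectral measure of $X_\phi$. For an estimator $e_\phi(x)$ (possibly containing a distribution in $\phi$) and a state $\rho$ put $$\overline{e}(\rho)=\int_0^\pi\frac{d\phi}{\pi}\int_{\mathbb R}\mathrm{Tr}[\rho\,dE_\phi(x)]\;e_\phi(x).$$ On a set of states, $e\simeq e'$ means that both double averages converge absolutely and that $e-e'$ is a null estimator there, i.e. $\overline{e}(\rho)-\overline{e'}(\rho)=0$ for all $\rho$ in the set. Let $\delta_\pi$ be the Dirac delta at $\phi=0$ on $[0,\pi)$, $\int_0^\pi\delta_\pi(\phi)g(\phi)\,d\phi=g(0)$, and for $0<\epsilon<1$ let $\delta_\pi^{\epsilon}(\phi)=\frac1\pi\sum_{n\in\mathbb Z}\epsilon^{|n|}e^{2in\phi}$ be its Poisson form. Let $f(z)=\sum_k a_kz^k$ be an entire function. Then $$f(x^2)\,\delta_\pi(\phi)\simeq\frac1\pi\left[\frac{f(x^2e^{2i\phi})}{1-e^{-2i\phi}}+\frac{f(x^2e^{-2i\phi})}{1-e^{2i\phi}}\right]$$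 on the states with $\sum_k(k+1)|a_k|\int_0^\pi\frac{d\phi}\pi\langle X_\phi^{2k}\rangle<\infty$, and $$x f(x^2)\,\delta_\pi(\phi)\simeq\frac1\pi\left[\frac{xe^{i\phi}f(x^2e^{2i\phi})}{1-e^{-2i\phi}}+\frac{xe^{-i\phi}f(x^2e^{-2i\phi})}{1-e^{2i\phi}}\right]$$ on the states with $\sum_k(k+2)|a_k|\int_0^\pi\frac{d\phi}\pi\langle X_\phi^{2k+2}\rangle<\infty$. In particular, on all states, $\delta_\pi(\phi)\simeq\frac1\pi$. The three relations also hold, on the same states and in the limit $\epsilon\to1^-$ of the double averages, with the left-hand sides replaced by $f(x^2)\,\delta^\epsilon_\pi(\phi)$, $x f(x^2)\,e^{i\phi}\delta^\epsilon_\pi(\phi)$ and $\delta^\epsilon_\pi(\phi)$, respectively. -/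

import Mathlib

noncomputable section

open MeasureTheory Filter Topology Polynomial
open scoped ENNReal ContDiff

namespace Homodyne

/-! ### Number-state wave functions

With `X_0 = (a + a†) / 2` and `[a, a†] = 1`, the `n`-th number state has in the position
representation the wave function
`u_n(x) = (2/π)^(1/4) (n!)^(-1/2) He_n(2 x) exp(-x²)`, `He_n` the probabilists' Hermite polynomial.
They are shown to form an orthonormal basis of `L²(ℝ)`. -/

/-- The probabilists' Hermite polynomial `He_n` over `ℝ`. -/
def hermiteR (n : ℕ) : ℝ[X] := (Polynomial.hermite n).map (Int.castRingHom ℝ)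

theorem hermiteR_zero : hermiteR 0 = 1 := by simp [hermiteR]

theorem hermiteR_succ (n : ℕ) :
    hermiteR (n + 1) = X * hermiteR n - derivative (hermiteR n) := by
  simp [hermiteR, Polynomial.hermite_succ, Polynomial.derivative_map]

theorem derivative_hermiteR (n : ℕ) :
    derivative (hermiteR (n + 1)) = ((n : ℝ[X]) + 1) * hermiteR n := by
  induction n with
  | zero => simp [hermiteR]
  | succ n ih =>
    rw [hermiteR_succ (n + 1), derivative_sub, derivative_mul, derivative_X, ih, derivative_mul]
    rw [hermiteR_succ n]
    have : derivative ((n : ℝ[X]) + 1) = 0 := by simp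
    rw [this]
    push_cast
    ring

theorem hermiteR_recurrence (n : ℕ) :
    X * hermiteR (n + 1) = hermiteR (n + 2) + ((n : ℝ[X]) + 1) * hermiteR n := by
  rw [hermiteR_succ (n + 1), derivative_hermiteR]; ring

theorem integrable_poly_gauss (p : ℝ[X]) {b : ℝ} (hb : 0 < b) :
    Integrable fun x : ℝ => p.eval x * Real.exp (-b * x ^ 2) := by
  induction p using Polynomial.induction_on' with
  | add p q hp hq => simp only [eval_add, add_mul]; exact hp.add hq
  | monomial n a =>
    have h := integrable_rpow_mul_exp_neg_mul_sq hb (s := n) (by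
      have : (0 : ℝ) ≤ n := Nat.cast_nonneg n
      linarith)
    simpa [mul_assoc] using h.const_mul a

theorem integral_poly_gauss_ibp (p : ℝ[X]) :
    ∫ y : ℝ, (X * p - derivative p).eval y * Real.exp (-(1 / 2) * y ^ 2) = 0 := by
  have h := integral_eq_zero_of_hasDerivAt_of_integrable
    (f := fun y : ℝ => -(p.eval y * Real.exp (-(1 / 2) * y ^ 2)))
    (f' := fun y : ℝ => (X * p - derivative p).eval y * Real.exp (-(1 / 2) * y ^ 2)) ?_ ?_ ?_
  · exact h
  · intro y
    have h1 : HasDerivAt (fun y : ℝ => Real.exp (-(1 / 2) * y ^ 2))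
        (Real.exp (-(1 / 2) * y ^ 2) * (-(1 / 2) * (2 * y))) y := by
      have := ((hasDerivAt_pow 2 y).const_mul (-(1 / 2 : ℝ))).exp
      simpa using this
    have h2 := ((p.hasDerivAt y).mul h1).neg
    refine h2.congr_deriv ?_
    simp only [eval_sub, eval_mul, eval_X]
    ring
  · exact integrable_poly_gauss _ (by norm_num)
  · exact (integrable_poly_gauss _ (by norm_num)).neg

theorem integral_hermiteR_mul (n m : ℕ) :
    ∫ y : ℝ, (hermiteR n * hermiteR m).eval y * Real.exp (-(1 / 2) * y ^ 2) =
      if n = m then (n.factorial : ℝ) * √(2 * Real.pi) else 0 := by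
  induction n generalizing m with
  | zero =>
    cases m with
    | zero =>
      have := integral_gaussian (1 / 2)
      simp only [hermiteR_zero, mul_one, eval_one, one_mul, this]
      simp [mul_comm]
    | succ m =>
      rw [hermiteR_zero, one_mul, hermiteR_succ, integral_poly_gauss_ibp]
      simp
  | succ n ih =>
    have key : ∫ y : ℝ, (hermiteR (n + 1) * hermiteR m).eval y * Real.exp (-(1 / 2) * y ^ 2) =
        ∫ y : ℝ, (hermiteR n * derivative (hermiteR m)).eval y *
          Real.exp (-(1 / 2) * y ^ 2) := by
      rw [← sub_eq_zero, ← integral_sub (integrable_poly_gauss _ (by norm_num))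
        (integrable_poly_gauss _ (by norm_num)), ← integral_poly_gauss_ibp (hermiteR n * hermiteR m)]
      congr 1
      ext y
      rw [← sub_mul, ← eval_sub]
      congr 2
      rw [hermiteR_succ, derivative_mul]; ring
    rw [key]
    cases m with
    | zero => simp [hermiteR_zero]
    | succ m =>
      have : ∀ y : ℝ, (hermiteR n * derivative (hermiteR (m + 1))).eval y *
          Real.exp (-(1 / 2) * y ^ 2) =
          ((m : ℝ) + 1) * ((hermiteR n * hermiteR m).eval y * Real.exp (-(1 / 2) * y ^ 2)) := by
        intro y; rw [derivative_hermiteR]; simp; ring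
      simp_rw [this]
      rw [integral_const_mul, ih]
      by_cases h : n = m
      · subst h; simp [Nat.factorial_succ]; ring
      · simp [h]

/-- The wave function `u_n` of the `n`-th number state. -/
def numberFn (n : ℕ) (x : ℝ) : ℝ :=
  √(√(2 / Real.pi) / (n.factorial : ℝ)) * (hermiteR n).eval (2 * x) * Real.exp (-x ^ 2)

theorem integral_numberFn_mul (n m : ℕ) :
    ∫ x : ℝ, numberFn n x * numberFn m x = if n = m then 1 else 0 := by
  have h1 : ∀ x : ℝ, numberFn n x * numberFn m x =
      √(√(2 / Real.pi) / (n.factorial : ℝ)) * √(√(2 / Real.pi) / (m.factorial : ℝ)) *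
      (fun y : ℝ => (hermiteR n * hermiteR m).eval y * Real.exp (-(1 / 2) * y ^ 2)) (2 * x) := by
    intro x
    have : Real.exp (-(1 / 2) * (2 * x) ^ 2) = Real.exp (-x ^ 2) * Real.exp (-x ^ 2) := by
      rw [← Real.exp_add]; congr 1; ring
    simp only [numberFn, eval_mul, this]; ring
  simp_rw [h1]
  rw [integral_const_mul, Measure.integral_comp_mul_left
    (fun y : ℝ => (hermiteR n * hermiteR m).eval y * Real.exp (-(1 / 2) * y ^ 2)),
    integral_hermiteR_mul]
  by_cases h : n = m
  · subst h
    simp only [if_true, smul_eq_mul]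
    rw [Real.mul_self_sqrt (by positivity)]
    have hn : (n.factorial : ℝ) ≠ 0 := by positivity
    have h2 : √(2 / Real.pi) * √(2 * Real.pi) = 2 := by
      rw [← Real.sqrt_mul (by positivity)]
      have : 2 / Real.pi * (2 * Real.pi) = 2 ^ 2 := by
        field_simp
      rw [this]; exact Real.sqrt_sq (by norm_num)
    have h3 : |(2 : ℝ)⁻¹| = 2⁻¹ := abs_of_pos (by norm_num)
    rw [h3]
    field_simp
    rw [h2]
  · simp [h]

theorem continuous_numberFn (n : ℕ) : Continuous (numberFn n) := by
  unfold numberFn; fun_prop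

theorem numberFn_mul_eq (n m : ℕ) (x : ℝ) : numberFn n x * numberFn m x =
    (C (√(√(2 / Real.pi) / (n.factorial : ℝ)) * √(√(2 / Real.pi) / (m.factorial : ℝ))) *
      ((hermiteR n * hermiteR m).comp (C 2 * X))).eval x * Real.exp (-2 * x ^ 2) := by
  have : Real.exp (-2 * x ^ 2) = Real.exp (-x ^ 2) * Real.exp (-x ^ 2) := by
    rw [← Real.exp_add]; congr 1; ring
  rw [this]
  simp only [numberFn, eval_mul, eval_C, eval_comp, eval_X]
  ring

theorem memLp_numberFn (n : ℕ) :
    MemLp (fun x : ℝ => (numberFn n x : ℂ)) 2 volume := by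
  rw [memLp_two_iff_integrable_sq_norm
    (f := fun x : ℝ => (numberFn n x : ℂ))
    (Complex.continuous_ofReal.comp (continuous_numberFn n)).aestronglyMeasurable]
  refine (integrable_poly_gauss
    (C (√(√(2 / Real.pi) / (n.factorial : ℝ)) * √(√(2 / Real.pi) / (n.factorial : ℝ))) *
      ((hermiteR n * hermiteR n).comp (C 2 * X))) (b := 2) (by norm_num)).congr ?_
  refine Eventually.of_forall fun x => ?_
  simp only [← numberFn_mul_eq, Complex.norm_real, Real.norm_eq_abs, sq_abs]
  ring

/-- The `n`-th number state as a vector of `L²(ℝ)`. -/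
def numberL2 (n : ℕ) : Lp ℂ 2 (volume : Measure ℝ) := (memLp_numberFn n).toLp _

theorem orthonormal_numberL2 : Orthonormal ℂ numberL2 := by
  rw [orthonormal_iff_ite]
  intro n m
  rw [L2.inner_def]
  have : ∀ᵐ x : ℝ, inner ℂ (numberL2 n x) (numberL2 m x) =
      ((numberFn n x * numberFn m x : ℝ) : ℂ) := by
    filter_upwards [(memLp_numberFn n).coeFn_toLp, (memLp_numberFn m).coeFn_toLp] with x hn hm
    simp only [numberL2, hn, hm]
    simp [mul_comm]
  have h2 := integral_ofReal (𝕜 := ℂ) (μ := volume) (f := fun x => numberFn n x * numberFn m x)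
  rw [integral_numberFn_mul] at h2
  rw [integral_congr_ae this]
  refine h2.trans ?_
  split_ifs <;> simp

theorem ae_zero_of_fourier_zero {h : ℝ → ℂ} (hi : Integrable h)
    (h0 : ∀ t : ℝ, ∫ x : ℝ, Complex.exp (t * x * Complex.I) * h x = 0) : h =ᵐ[volume] 0 := by
  have hF : ∀ ξ : ℝ, FourierTransform.fourier h ξ = 0 := by
    intro ξ
    rw [Real.fourier_real_eq_integral_exp_smul, ← h0 (-2 * Real.pi * ξ)]
    refine integral_congr_ae (Eventually.of_forall fun x => ?_)
    simp only [smul_eq_mul]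
    congr 2
    push_cast
    ring
  refine ae_eq_zero_of_integral_contDiff_smul_eq_zero hi.locallyIntegrable ?_
  intro g hg hgs
  have hg₁ : HasCompactSupport (Complex.ofRealCLM ∘ g) := hgs.comp_left rfl
  have hg₂ : ContDiff ℝ ∞ (Complex.ofRealCLM ∘ g) := by fun_prop
  set G : SchwartzMap ℝ ℂ := hg₁.toSchwartzMap hg₂ with hG
  set K : SchwartzMap ℝ ℂ := FourierTransformInv.fourierInv G with hK
  have hGK : FourierTransform.fourier K = G := FourierTransform.fourier_fourierInv_eq G
  have hKG : ∀ x, FourierTransform.fourier (K : ℝ → ℂ) x = G x := by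
    intro x; rw [← SchwartzMap.fourier_coe, hGK]
  have hflip := VectorFourier.integral_fourierIntegral_smul_eq_flip (L := innerₗ ℝ)
    (μ := volume) (ν := volume) (f := (K : ℝ → ℂ)) (g := h)
      Real.continuous_fourierChar continuous_inner K.integrable hi
  have e1 : ∀ x, VectorFourier.fourierIntegral Real.fourierChar volume (innerₗ ℝ) (K : ℝ → ℂ) x
      = G x := hKG
  have e2 : ∀ x, VectorFourier.fourierIntegral Real.fourierChar volume (innerₗ ℝ).flip h x = 0 := by
    intro x
    rw [flip_innerₗ]
    exact hF x
  simp_rw [e1, e2] at hflip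
  simpa [hG] using hflip

theorem memLp_exp (t : ℝ) :
    MemLp (fun x : ℝ => Real.exp (|t * x| - x ^ 2)) 2 volume := by
  have hc : Continuous fun x : ℝ => Real.exp (|t * x| - x ^ 2) := by fun_prop
  rw [memLp_two_iff_integrable_sq hc.aestronglyMeasurable]
  refine ((integrable_exp_neg_mul_sq (b := 1) (by norm_num)).const_mul
    (Real.exp (t ^ 2))).mono' (hc.pow 2).aestronglyMeasurable (Eventually.of_forall fun x => ?_)
  rw [Real.norm_of_nonneg (by positivity), ← Real.exp_nat_mul, ← Real.exp_add]
  refine Real.exp_le_exp.2 ?_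
  push_cast
  rw [abs_mul]
  nlinarith [sq_nonneg (|t| - |x|), sq_abs t, sq_abs x]

theorem memLp_poly (p : ℝ[X]) :
    MemLp (fun x : ℝ => ((p.eval (2 * x) * Real.exp (-x ^ 2) : ℝ) : ℂ)) 2 volume := by
  have hc : Continuous fun x : ℝ => ((p.eval (2 * x) * Real.exp (-x ^ 2) : ℝ) : ℂ) := by fun_prop
  rw [memLp_two_iff_integrable_sq_norm hc.aestronglyMeasurable]
  refine (integrable_poly_gauss ((p * p).comp (C 2 * X)) (b := 2) (by norm_num)).congr
    (Eventually.of_forall fun x => ?_)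
  have : Real.exp (-2 * x ^ 2) = Real.exp (-x ^ 2) * Real.exp (-x ^ 2) := by
    rw [← Real.exp_add]; congr 1; ring
  simp only [eval_comp, eval_mul, eval_C, eval_X, Complex.norm_real, Real.norm_eq_abs, sq_abs, this]
  ring

theorem numberL2_complete :
    (Submodule.span ℂ (Set.range numberL2))ᗮ = ⊥ := by
  rw [Submodule.eq_bot_iff]
  intro g hg
  have hgi : ∀ F : ℝ → ℂ, MemLp F 2 volume → Integrable fun x => F x * g x := fun F hF =>
    hF.integrable_mul (Lp.memLp g)
  let Λ : ℝ[X] → ℂ := fun p => ∫ x : ℝ, ((p.eval (2 * x) * Real.exp (-x ^ 2) : ℝ) : ℂ) * g x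
  have hΛadd : ∀ p q, Λ (p + q) = Λ p + Λ q := by
    intro p q
    simp only [Λ]
    rw [← integral_add (hgi _ (memLp_poly p)) (hgi _ (memLp_poly q))]
    refine integral_congr_ae (Eventually.of_forall fun x => ?_)
    simp only [eval_add]; push_cast; ring
  have hΛC : ∀ (c : ℝ) p, Λ (C c * p) = c * Λ p := by
    intro c p
    simp only [Λ]
    rw [← integral_const_mul]
    refine integral_congr_ae (Eventually.of_forall fun x => ?_)
    simp only [eval_mul, eval_C]; push_cast; ring
  have hΛh : ∀ n, Λ (hermiteR n) = 0 := by
    intro n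
    have h1 : inner ℂ (numberL2 n) g = 0 :=
      (Submodule.mem_orthogonal _ _).1 hg _ (Submodule.subset_span ⟨n, rfl⟩)
    rw [L2.inner_def] at h1
    have h2 : ∫ x : ℝ, inner ℂ (numberL2 n x) (g x) =
        ∫ x : ℝ, ((√(√(2 / Real.pi) / (n.factorial : ℝ)) : ℝ) : ℂ) *
          (((hermiteR n).eval (2 * x) * Real.exp (-x ^ 2) : ℝ) * g x) := by
      refine integral_congr_ae ?_
      filter_upwards [(memLp_numberFn n).coeFn_toLp] with x hn
      simp only [numberL2, hn, RCLike.inner_apply, Complex.conj_ofReal]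
      simp only [numberFn]; push_cast; ring
    rw [h2, integral_const_mul] at h1
    rcases mul_eq_zero.1 h1 with h | h
    · exfalso
      have : 0 < √(√(2 / Real.pi) / (n.factorial : ℝ)) := by positivity
      exact this.ne' (by exact_mod_cast h)
    · exact h
  have hΛX : ∀ k n, Λ (X ^ k * hermiteR n) = 0 := by
    intro k
    induction k with
    | zero => intro n; simpa using hΛh n
    | succ k ih =>
      intro n
      cases n with
      | zero =>
        have : X ^ (k + 1) * hermiteR 0 = X ^ k * hermiteR 1 := by
          rw [hermiteR_succ, hermiteR_zero]; simp [pow_succ]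
        rw [this, ih]
      | succ n =>
        have : X ^ (k + 1) * hermiteR (n + 1) =
            X ^ k * hermiteR (n + 2) + C ((n : ℝ) + 1) * (X ^ k * hermiteR n) := by
          rw [pow_succ, mul_assoc, hermiteR_recurrence]; simp; ring
        rw [this, hΛadd, hΛC, ih, ih]; simp
  have hmono : ∀ k : ℕ, ∫ x : ℝ, ((2 * x : ℝ) : ℂ) ^ k * (Real.exp (-x ^ 2) * g x) = 0 := by
    intro k
    have := hΛX k 0
    rw [hermiteR_zero, mul_one] at this
    rw [← this]
    refine integral_congr_ae (Eventually.of_forall fun x => ?_)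
    simp only [eval_pow, eval_X]; push_cast; ring
  have hzero : (fun x : ℝ => (Real.exp (-x ^ 2) : ℂ) * g x) =ᵐ[volume] 0 := by
    refine ae_zero_of_fourier_zero ?_ ?_
    · have := hgi _ (memLp_poly 1)
      simpa using this
    · intro t
      have hs := hasSum_integral_of_dominated_convergence (μ := volume)
        (F := fun (k : ℕ) (x : ℝ) => (t * x * Complex.I) ^ k / (k.factorial : ℂ) *
          ((Real.exp (-x ^ 2) : ℂ) * g x))
        (f := fun x : ℝ => Complex.exp (t * x * Complex.I) * ((Real.exp (-x ^ 2) : ℂ) * g x))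
        (fun k x => |t * x| ^ k / (k.factorial : ℝ) * (Real.exp (-x ^ 2) * ‖g x‖)) ?_ ?_ ?_ ?_ ?_
      · refine hs.unique ?_
        convert hasSum_zero with k
        have : ∀ x : ℝ, (t * x * Complex.I) ^ k / (k.factorial : ℂ) * ((Real.exp (-x ^ 2) : ℂ) * g x) =
            ((t * Complex.I / 2) ^ k / (k.factorial : ℂ)) *
              (((2 * x : ℝ) : ℂ) ^ k * (Real.exp (-x ^ 2) * g x)) := by
          intro x
          have : (t * x * Complex.I : ℂ) = (t * Complex.I / 2) * ((2 * x : ℝ) : ℂ) := by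
            push_cast; ring
          rw [this, mul_pow]; ring
        simp_rw [this]
        rw [integral_const_mul, hmono, mul_zero]
      · intro k
        refine AEStronglyMeasurable.mul ?_ (AEStronglyMeasurable.mul ?_ (Lp.aestronglyMeasurable g))
        · exact Continuous.aestronglyMeasurable (by fun_prop)
        · exact Continuous.aestronglyMeasurable (by fun_prop)
      · intro k
        refine Eventually.of_forall fun x => le_of_eq ?_
        simp only [norm_mul, norm_div, norm_pow, Complex.norm_real, Complex.norm_I, mul_one,
          Complex.norm_natCast, Real.norm_eq_abs, abs_mul, abs_of_pos (Real.exp_pos _)]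
      · refine Eventually.of_forall fun x => ?_
        exact (Real.summable_pow_div_factorial _).mul_right _
      · have h1 := ((memLp_exp t).integrable_mul (Lp.memLp g).norm)
        refine h1.congr (Eventually.of_forall fun x => ?_)
        have h2 : HasSum (fun k : ℕ => |t * x| ^ k / (k.factorial : ℝ)) (Real.exp |t * x|) := by
          rw [Real.exp_eq_exp_ℝ]; exact NormedSpace.expSeries_div_hasSum_exp _
        have h3 := (h2.mul_right (Real.exp (-x ^ 2) * ‖g x‖)).tsum_eq
        simp only [Pi.mul_apply]
        rw [h3, sub_eq_add_neg, Real.exp_add]; ring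
      · refine Eventually.of_forall fun x => ?_
        have h2 : HasSum (fun k : ℕ => (t * x * Complex.I : ℂ) ^ k / (k.factorial : ℂ))
            (Complex.exp (t * x * Complex.I)) := by
          rw [Complex.exp_eq_exp_ℂ]; exact NormedSpace.expSeries_div_hasSum_exp _
        exact h2.mul_right _
  rw [Lp.eq_zero_iff_ae_eq_zero]
  filter_upwards [hzero] with x hx
  have : (Real.exp (-x ^ 2) : ℂ) ≠ 0 := by exact_mod_cast (Real.exp_pos _).ne'
  simpa [this] using hx

theorem orthonormal_phase (φ : ℝ) : Orthonormal ℂ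
    fun n : ℕ => Complex.exp (-(n * φ) * Complex.I) • numberL2 n := by
  have h := orthonormal_iff_ite.1 orthonormal_numberL2
  rw [orthonormal_iff_ite]
  intro n m
  rw [inner_smul_left, inner_smul_right, h]
  split_ifs with hnm
  · subst hnm
    rw [mul_one, mul_comm, Complex.mul_conj, Complex.normSq_eq_norm_sq]
    have : (-(n * φ) * Complex.I : ℂ) = ((-(n * φ) : ℝ) : ℂ) * Complex.I := by push_cast; ring
    rw [this, Complex.norm_exp_ofReal_mul_I]; simp
  · simp

theorem complete_phase (φ : ℝ) : (Submodule.span ℂ (Set.range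
    fun n : ℕ => Complex.exp (-(n * φ) * Complex.I) • numberL2 n))ᗮ = ⊥ := by
  rw [eq_bot_iff, ← numberL2_complete]
  refine Submodule.orthogonal_le (Submodule.span_le.2 ?_)
  rintro _ ⟨n, rfl⟩
  have h : Complex.exp (-(n * φ) * Complex.I) • numberL2 n ∈ Submodule.span ℂ (Set.range
      fun n : ℕ => Complex.exp (-(n * φ) * Complex.I) • numberL2 n) :=
    Submodule.subset_span ⟨n, rfl⟩
  have h2 := Submodule.smul_mem _ (Complex.exp (-(n * φ) * Complex.I))⁻¹ h
  rwa [smul_smul, inv_mul_cancel₀ (Complex.exp_ne_zero _), one_smul] at h2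

/-! ### The oscillator, its quadratures and their spectral representation -/

/-- The Hilbert space of the harmonic oscillator, `ℓ²(ℕ)` in the number basis `|0⟩, |1⟩, …`. -/
abbrev Fock : Type := lp (fun _ : ℕ => ℂ) 2

/-- The wave functions `e^{-inφ} u_n(x) = ₍φ₎⟨x|n⟩` of the number states in the eigenrepresentation
of the quadrature `X_φ`; they form a Hilbert basis of `L²(ℝ)`. -/
def quadratureBasis (φ : ℝ) : HilbertBasis ℕ ℂ (Lp ℂ 2 (volume : Measure ℝ)) :=
  HilbertBasis.mkOfOrthogonalEqBot (orthonormal_phase φ) (complete_phase φ)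

/-- The unitary spectral representation of `X_φ`: it sends `|n⟩` to `e^{-inφ} u_n` and turns `X_φ`
into multiplication by `x` (see `quadratureRep_quadrature`). -/
def quadratureRep (φ : ℝ) : Fock ≃ₗᵢ[ℂ] Lp ℂ 2 (volume : Measure ℝ) :=
  (quadratureBasis φ).repr.symm

/-- The annihilation operator `a|n⟩ = √n |n-1⟩` on finite superpositions of number states. -/
def annihilation : (ℕ →₀ ℂ) →ₗ[ℂ] (ℕ →₀ ℂ) :=
  Finsupp.linearCombination ℂ fun n : ℕ => Finsupp.single (n - 1) (√(n : ℝ) : ℂ)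

/-- The creation operator `a†|n⟩ = √(n+1) |n+1⟩` on finite superpositions of number states. -/
def creation : (ℕ →₀ ℂ) →ₗ[ℂ] (ℕ →₀ ℂ) :=
  Finsupp.linearCombination ℂ fun n : ℕ => Finsupp.single (n + 1) (√((n : ℝ) + 1) : ℂ)

/-- The quadrature `X_φ = (a† e^{iφ} + a e^{-iφ}) / 2` on finite superpositions of number states. -/
def quadrature (φ : ℝ) : (ℕ →₀ ℂ) →ₗ[ℂ] (ℕ →₀ ℂ) :=
  (1 / 2 : ℂ) • (Complex.exp (φ * Complex.I) • creation +
    Complex.exp (-φ * Complex.I) • annihilation)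

/-- Finite superpositions of number states as vectors of the Hilbert space. -/
def toFock : (ℕ →₀ ℂ) →ₗ[ℂ] Fock :=
  Finsupp.linearCombination ℂ fun n : ℕ => (lp.single 2 n (1 : ℂ) : Fock)

theorem numberFn_recurrence (n : ℕ) (x : ℝ) : 2 * x * numberFn n x =
    √((n : ℝ) + 1) * numberFn (n + 1) x + √(n : ℝ) * numberFn (n - 1) x := by
  have hs : ∀ m : ℕ, √(√(2 / Real.pi) / (m.factorial : ℝ)) =
      √((m : ℝ) + 1) * √(√(2 / Real.pi) / ((m + 1).factorial : ℝ)) := by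
    intro m
    rw [← Real.sqrt_mul (by positivity), Nat.factorial_succ]
    congr 1
    push_cast
    field_simp
  cases n with
  | zero =>
    simp only [numberFn, hs 0, hermiteR_succ, hermiteR_zero]
    simp; ring
  | succ n =>
    have h := congrArg (eval (2 * x)) (hermiteR_recurrence n)
    simp only [eval_mul, eval_X, eval_add, eval_natCast, eval_one] at h
    have h1 := hs (n + 1)
    have h0 := hs n
    have hsq : √((n : ℝ) + 1) * √((n : ℝ) + 1) = n + 1 := Real.mul_self_sqrt (by positivity)
    simp only [numberFn, Nat.add_sub_cancel]
    push_cast at h1 ⊢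
    calc 2 * x * (√(√(2 / Real.pi) / ((n + 1).factorial : ℝ)) * (hermiteR (n + 1)).eval (2 * x) *
          Real.exp (-x ^ 2)) = √(√(2 / Real.pi) / ((n + 1).factorial : ℝ)) *
          (2 * x * (hermiteR (n + 1)).eval (2 * x)) * Real.exp (-x ^ 2) := by ring
      _ = _ := by
        rw [h, h0]
        nth_rewrite 1 [mul_add, h1]
        linear_combination (-(√(√(2 / Real.pi) / ((n + 1).factorial : ℝ)) *
          eval (2 * x) (hermiteR n) * Real.exp (-x ^ 2))) * hsq

theorem quadratureRep_single (φ : ℝ) (n : ℕ) (c : ℂ) :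
    quadratureRep φ (toFock (Finsupp.single n c)) =
      (c * Complex.exp (-(n * φ) * Complex.I)) • numberL2 n := by
  simp only [toFock, Finsupp.linearCombination_single, map_smul, quadratureRep]
  rw [HilbertBasis.repr_symm_single]
  simp [quadratureBasis, smul_smul]

/-- `quadratureRep φ` diagonalizes the quadrature `X_φ = (a† e^{iφ} + a e^{-iφ}) / 2`. -/
theorem quadratureRep_quadrature (φ : ℝ) (v : ℕ →₀ ℂ) :
    quadratureRep φ (toFock (quadrature φ v)) =ᵐ[volume]
      fun x : ℝ => (x : ℂ) * quadratureRep φ (toFock v) x := by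
  induction v using Finsupp.induction_linear with
  | zero =>
    simp only [map_zero]
    filter_upwards [Lp.coeFn_zero ℂ 2 (volume : Measure ℝ)] with x hx
    simp
  | add v w hv hw =>
    simp only [map_add]
    filter_upwards [hv, hw, Lp.coeFn_add (quadratureRep φ (toFock (quadrature φ v)))
      (quadratureRep φ (toFock (quadrature φ w))),
      Lp.coeFn_add (quadratureRep φ (toFock v)) (quadratureRep φ (toFock w))] with x h1 h2 h3 h4
    rw [h3, h4, Pi.add_apply, Pi.add_apply, h1, h2, mul_add]
  | single n c =>
    have hq : quadratureRep φ (toFock (quadrature φ (Finsupp.single n c))) =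
        (c * Complex.exp (-(n * φ) * Complex.I) * (1 / 2) * √((n : ℝ) + 1) : ℂ) •
            numberL2 (n + 1) +
          (c * Complex.exp (-(n * φ) * Complex.I) * (1 / 2) * √(n : ℝ) : ℂ) •
            numberL2 (n - 1) := by
      simp only [quadrature, creation, annihilation, LinearMap.smul_apply, LinearMap.add_apply,
        Finsupp.linearCombination_single, map_smul, map_add, quadratureRep_single, smul_smul,
        smul_add]
      congr 2
      · have : Complex.exp (-(n * φ) * Complex.I) = Complex.exp (φ * Complex.I) *
            Complex.exp (-(((n + 1 : ℕ) : ℂ) * φ) * Complex.I) := by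
          rw [← Complex.exp_add]; congr 1; push_cast; ring
        rw [this]; ring
      · cases n with
        | zero => simp
        | succ n =>
          have : Complex.exp (-(((n + 1 : ℕ) : ℂ) * φ) * Complex.I) =
              Complex.exp (-φ * Complex.I) * Complex.exp (-((n : ℂ) * φ) * Complex.I) := by
            rw [← Complex.exp_add]; congr 1; push_cast; ring
          rw [this]; simp only [Nat.add_sub_cancel]; ring
    rw [hq, quadratureRep_single]
    filter_upwards [Lp.coeFn_add ((c * Complex.exp (-(n * φ) * Complex.I) * (1 / 2) *
        √((n : ℝ) + 1) : ℂ) • numberL2 (n + 1)) ((c * Complex.exp (-(n * φ) * Complex.I) *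
        (1 / 2) * √(n : ℝ) : ℂ) • numberL2 (n - 1)),
      Lp.coeFn_smul (c * Complex.exp (-(n * φ) * Complex.I) * (1 / 2) *
        √((n : ℝ) + 1) : ℂ) (numberL2 (n + 1)),
      Lp.coeFn_smul (c * Complex.exp (-(n * φ) * Complex.I) * (1 / 2) *
        √(n : ℝ) : ℂ) (numberL2 (n - 1)),
      Lp.coeFn_smul (c * Complex.exp (-(n * φ) * Complex.I)) (numberL2 n),
      (memLp_numberFn n).coeFn_toLp, (memLp_numberFn (n + 1)).coeFn_toLp,
      (memLp_numberFn (n - 1)).coeFn_toLp] with x h1 h2 h3 h4 h5 h6 h7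
    rw [h1, Pi.add_apply, h2, h3, h4]
    simp only [Pi.smul_apply, smul_eq_mul, numberL2, h5, h6, h7]
    have h := congrArg (fun r : ℝ => (r : ℂ)) (numberFn_recurrence n x)
    push_cast at h
    linear_combination (-(c * Complex.exp (-(n * φ) * Complex.I) * (1 / 2))) * h

/-! ### Ensemble averages of estimators -/

/-- A (generally mixed) state `ρ = ∑ j, |ψ_j⟩⟨ψ_j|` with `Tr ρ = ∑ j, ‖ψ_j‖² = 1`; every density
operator is of this form, and the pure states are those with one nonzero `ψ_j`. -/
structure State where
  /-- The unnormalized vectors of the ensemble. -/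
  vec : ℕ → Fock
  hasSum_norm_sq : HasSum (fun j => ‖vec j‖ ^ 2) 1

/-- The measure `⟨dE_φ(x)⟩ = Tr[ρ dE_φ(x)]`, where `E_φ` is the spectral measure of `X_φ`:
since `quadratureRep φ` turns `X_φ` into multiplication by `x`, one has
`⟨ψ, E_φ(B) ψ⟩ = ∫_B |quadratureRep φ ψ|²`. -/
def State.outcome (ρ : State) (φ : ℝ) : Measure ℝ :=
  Measure.sum fun j : ℕ => (volume : Measure ℝ).withDensity
    fun x => ‖quadratureRep φ (ρ.vec j) x‖ₑ ^ 2

/-- The probability measure `dφ/π` on the quorum `[0, π)`. -/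
def phaseMeasure : Measure ℝ :=
  ENNReal.ofReal (1 / Real.pi) • (volume : Measure ℝ).restrict (Set.Ico 0 Real.pi)

/-- An estimator, possibly containing a distribution (a measure) in the phase variable: a function
`val φ x` of the phase `φ` and of the outcome `x`, together with the measure `weight` on the phases
against which it is averaged, and which is `dφ/π` for an ordinary function. -/
structure Estimator where
  /-- The measure on the phases. -/
  weight : Measure ℝ
  /-- The function of phase and outcome. -/
  val : ℝ → ℝ → ℂ

/-- An ordinary estimator function `n φ x`. -/
def Estimator.ofFun (n : ℝ → ℝ → ℂ) : Estimator := ⟨phaseMeasure, n⟩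

/-- The estimator `n φ x * δ_π(φ)`, `δ_π` being the Dirac delta at `φ = 0` on the interval
`[0, π)`, normalized by `∫_0^π δ_π(φ) dφ = 1`; so `δ_π(φ) dφ/π` is `1/π` times the unit mass. -/
def Estimator.mulDelta (n : ℝ → ℝ → ℂ) : Estimator :=
  ⟨ENNReal.ofReal (1 / Real.pi) • Measure.dirac 0, n⟩

/-- The double average of the estimator over phases and outcomes converges absolutely. -/
def Estimator.Converges (e : Estimator) (ρ : State) : Prop :=
  (∀ᵐ φ ∂e.weight, Integrable (e.val φ) (ρ.outcome φ)) ∧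
  Integrable (fun φ => ∫ x, e.val φ x ∂(ρ.outcome φ)) e.weight ∧
  ∫⁻ φ, ∫⁻ x, ‖e.val φ x‖ₑ ∂(ρ.outcome φ) ∂e.weight < ⊤

/-- The double average `∫ dμ(φ) ∫ ⟨dE_φ(x)⟩ e_φ(x)` in the state `ρ`. -/
def Estimator.mean (e : Estimator) (ρ : State) : ℂ :=
  ∫ φ, ∫ x, e.val φ x ∂(ρ.outcome φ) ∂e.weight

/-- `e ≃ e'` on the states of `S`: both double averages converge absolutely, and that of the
difference vanishes. -/
def Estimator.Equiv (S : Set State) (e e' : Estimator) : Prop :=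
  ∀ ρ ∈ S, e.Converges ρ ∧ e'.Converges ρ ∧ e.mean ρ - e'.mean ρ = 0

/-- `e ε ≃ e'` in the limit `ε → 1⁻`, on the states of `S`. -/
def Estimator.LimEquiv (S : Set State) (e : ℝ → Estimator) (e' : Estimator) : Prop :=
  ∀ ρ ∈ S, (∀ᶠ ε in 𝓝[<] (1 : ℝ), (e ε).Converges ρ) ∧ e'.Converges ρ ∧
    Tendsto (fun ε => (e ε).mean ρ - e'.mean ρ) (𝓝[<] 1) (𝓝 0)

/-- The Poisson form of `δ_π` at regularization `ε < 1`:
`(1/π) ∑_{n ∈ ℤ} ε^|n| e^{2inφ}`. -/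
def poissonDelta (ε φ : ℝ) : ℂ :=
  (1 / Real.pi : ℂ) * ∑' n : ℤ, (ε : ℂ) ^ n.natAbs * Complex.exp (2 * n * φ * Complex.I)

/-- The `k`-th Taylor coefficient of `f` at `0`. -/
def taylorCoeff (f : ℂ → ℂ) (k : ℕ) : ℂ := iteratedDeriv k f 0 / (k.factorial : ℂ)

/-- The averaged moment `∫ dφ/π ⟨X_φ^{2k}⟩`. -/
def State.meanMoment (ρ : State) (k : ℕ) : ℝ≥0∞ :=
  ∫⁻ φ, ∫⁻ x, ‖x‖ₑ ^ (2 * k) ∂(ρ.outcome φ) ∂phaseMeasure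

/-- The states on which the ensemble average of `f(X_φ²)`, `f(z) = ∑ k, a_k z^k` entire, is well
defined through the power series: `∑ k, (k+1) |a_k| ∫ dφ/π ⟨X_φ^{2k}⟩ < ∞`. -/
def domainOf (f : ℂ → ℂ) : Set State :=
  {ρ | ∑' k : ℕ, ((k : ℝ≥0∞) + 1) * ‖taylorCoeff f k‖ₑ * ρ.meanMoment k < ⊤}

end Homodyne

end

noncomputable section

open MeasureTheory Filter Topology Polynomial
open scoped ENNReal ContDiff

namespace Homodyne

/-! ### Trigonometric polynomials on the quorum -/

/-! Expanding in powers of `a` and `a†`, the moment `⟨X_φ^m⟩` is a trigonometric polynomial in `φ`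
with frequencies `-m, -m+2, …, m` only. The characters `e^{2inφ}` are orthonormal for `dφ/π` on `[0,
π)`, so the kernel `D_m = ∑_{i ≤ m} e^{i(2i-m)φ}` reproduces the value at `φ = 0` of every such
polynomial (`integral_dirichletKernel_mul`). Summing the geometric series gives `D_m =
e^{imφ}/(1-e^{-2iφ}) + e^{-imφ}/(1-e^{2iφ})` (`dirichletKernel_eq_div`); hence the right-hand sides
of the identities are `(1/π) ∑ a_k D_m(φ) x^m` with `m = 2k` or `m = 2k+1`, and the identities hold
term by term. The bounds `|D_m| ≤ m+1` and `|g(0)| ≤ (m+1) ∫ |g| dφ/π` for such polynomials `g` turn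
the domain condition into absolute convergence of both sides (`converges_and_hasSum_mean`). The
Poisson kernel multiplies the Fourier coefficients by powers of `ε`, which tend to `1`, and the same
bound holds uniformly in `ε`, so dominated convergence applies to the series.

The analytic difficulty is that only phase averaged moments are assumed finite, while the moments
are needed at every phase. The phase average removes the coherences: it equals `∑ |ψ_n|²
⟨n|X_0^{2k}|n⟩` (`lintegral_vecOutcome_moment`). The vectors `x^k u_n` are orthogonal when the
indices differ by more than `2k`, so this finite sum makes `∑ ψ_n e^{-inφ} x^k u_n` converge in `L²`
for every `φ` (`summable_of_band`). The moments are inner products of such series, hence pointwise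
limits of trigonometric polynomials of fixed degree; these form a finite-dimensional, therefore
closed, space. -/

/-- The character `φ ↦ e^{inφ}`. -/
def phaseExp (n : ℤ) (φ : ℝ) : ℂ := Complex.exp (n * φ * Complex.I)

theorem phaseExp_mul (m n : ℤ) (φ : ℝ) : phaseExp m φ * phaseExp n φ = phaseExp (m + n) φ := by
  simp only [phaseExp, ← Complex.exp_add]; congr 1; push_cast; ring

@[simp] theorem phaseExp_zero_left (φ : ℝ) : phaseExp 0 φ = 1 := by simp [phaseExp]

@[simp] theorem phaseExp_zero_right (n : ℤ) : phaseExp n 0 = 1 := by simp [phaseExp]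

@[simp] theorem norm_phaseExp (n : ℤ) (φ : ℝ) : ‖phaseExp n φ‖ = 1 := by
  have : (n * φ * Complex.I : ℂ) = ((n * φ : ℝ) : ℂ) * Complex.I := by push_cast; ring
  rw [phaseExp, this, Complex.norm_exp_ofReal_mul_I]

theorem conj_phaseExp (n : ℤ) (φ : ℝ) : (starRingEnd ℂ) (phaseExp n φ) = phaseExp (-n) φ := by
  simp only [phaseExp, ← Complex.exp_conj]; congr 1; simp

theorem phaseExp_pow (n : ℤ) (k : ℕ) (φ : ℝ) : phaseExp n φ ^ k = phaseExp (k * n) φ := by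
  simp only [phaseExp, ← Complex.exp_nat_mul]; congr 1; push_cast; ring

@[fun_prop] theorem continuous_phaseExp (n : ℤ) : Continuous (phaseExp n) := by
  unfold phaseExp; fun_prop

theorem integral_phaseMeasure (g : ℝ → ℂ) :
    ∫ φ, g φ ∂phaseMeasure = (1 / Real.pi : ℂ) * ∫ φ in (0 : ℝ)..Real.pi, g φ := by
  rw [phaseMeasure, integral_smul_measure, intervalIntegral.integral_of_le Real.pi_pos.le,
    integral_Ico_eq_integral_Ioc, ENNReal.toReal_ofReal (by positivity)]
  simp

instance : IsProbabilityMeasure phaseMeasure := by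
  constructor
  simp only [phaseMeasure, Measure.smul_apply, Measure.restrict_apply_univ, Real.volume_Ico,
    sub_zero, smul_eq_mul]
  rw [← ENNReal.ofReal_mul (by positivity), one_div, inv_mul_cancel₀ Real.pi_pos.ne']
  simp

/-- The phase `0`, where the denominators of the closed forms vanish, is negligible for an ordinary
estimator. -/
theorem ae_phaseMeasure_Ioo : ∀ᵐ φ ∂phaseMeasure, φ ∈ Set.Ioo 0 Real.pi := by
  refine Measure.ae_smul_measure ?_ _
  rw [← restrict_Ioo_eq_restrict_Ico]
  exact ae_restrict_mem measurableSet_Ioo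

/-- On the half period `[0, π)` only the even frequencies are orthogonal; this is why parities are
tracked in all that follows. -/
theorem integral_phaseExp_two_mul (n : ℤ) :
    ∫ φ, phaseExp (2 * n) φ ∂phaseMeasure = if n = 0 then 1 else 0 := by
  split_ifs with h
  · subst h; simp
  · rw [integral_phaseMeasure]
    have hc : (((2 * n : ℤ) : ℂ) * Complex.I) ≠ 0 := by
      simp [h]
    have h1 : ∀ φ : ℝ, phaseExp (2 * n) φ = Complex.exp ((((2 * n : ℤ) : ℂ) * Complex.I) * φ) := by
      intro φ; simp only [phaseExp]; congr 1; ring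
    simp_rw [h1]
    rw [integral_exp_mul_complex hc]
    have : Complex.exp (((2 * n : ℤ) : ℂ) * Complex.I * Real.pi) = 1 := by
      rw [Complex.exp_eq_one_iff]; exact ⟨n, by push_cast; ring⟩
    rw [this]; simp

/-- The trigonometric polynomials of degree at most `m` whose frequencies have the parity
of `m`. -/
def trigSpan (m : ℕ) : Submodule ℂ (ℝ → ℂ) :=
  Submodule.span ℂ (Set.range fun i : Fin (m + 1) => phaseExp (2 * (i : ℕ) - m))

/-- The topology is that of pointwise convergence, so a pointwise limit of trigonometric polynomials
of fixed degree is again one, with no uniformity to check. -/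
theorem isClosed_trigSpan (m : ℕ) : IsClosed (trigSpan m : Set (ℝ → ℂ)) := by
  have : FiniteDimensional ℂ (trigSpan m) := FiniteDimensional.span_of_finite ℂ (Set.finite_range _)
  exact Submodule.closed_of_finiteDimensional _

theorem phaseExp_mem_trigSpan {m : ℕ} {n : ℤ} (h1 : |n| ≤ m) (h2 : Even (n + m)) :
    phaseExp n ∈ trigSpan m := by
  obtain ⟨r, hr⟩ := h2
  rw [abs_le] at h1
  -- Here `n + m = 2r` and `n ≥ -m`, so `r ≥ 0` and `toNat` truncates nothing.
  refine Submodule.subset_span ⟨⟨r.toNat, by omega⟩, ?_⟩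
  have : (2 * (r.toNat : ℤ) - m) = n := by omega
  simp only [this]

theorem mem_trigSpan_iff {m : ℕ} {g : ℝ → ℂ} : g ∈ trigSpan m ↔
    ∃ c : Fin (m + 1) → ℂ, g = fun φ => ∑ i, c i * phaseExp (2 * (i : ℕ) - m) φ := by
  rw [trigSpan, Submodule.mem_span_range_iff_exists_fun]
  constructor
  · rintro ⟨c, rfl⟩; exact ⟨c, by ext φ; simp⟩
  · rintro ⟨c, rfl⟩; exact ⟨c, by ext φ; simp⟩

theorem continuous_of_mem_trigSpan {m : ℕ} {g : ℝ → ℂ} (hg : g ∈ trigSpan m) : Continuous g := by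
  obtain ⟨c, rfl⟩ := mem_trigSpan_iff.1 hg
  fun_prop

theorem integrable_phaseMeasure_of_continuous {E : Type*} [NormedAddCommGroup E] {g : ℝ → E}
    (hg : Continuous g) :
    Integrable g phaseMeasure := by
  refine Integrable.smul_measure ?_ ENNReal.ofReal_ne_top
  exact (hg.continuousOn.integrableOn_compact isCompact_Icc).mono_set Set.Ico_subset_Icc_self

/-- The Fourier coefficients of a trigonometric polynomial. -/
theorem integral_mul_phaseExp_of_trig {m : ℕ} (c : Fin (m + 1) → ℂ) (j : Fin (m + 1)) :
    ∫ φ, (∑ i, c i * phaseExp (2 * (i : ℕ) - m) φ) * phaseExp (-(2 * (j : ℕ) - m)) φ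
      ∂phaseMeasure = c j := by
  have h : ∀ φ, (∑ i, c i * phaseExp (2 * (i : ℕ) - m) φ) * phaseExp (-(2 * (j : ℕ) - m)) φ =
      ∑ i, c i * phaseExp (2 * (((i : ℕ) : ℤ) - (j : ℕ))) φ := by
    intro φ
    rw [Finset.sum_mul]
    refine Finset.sum_congr rfl fun i _ => ?_
    rw [mul_assoc, phaseExp_mul]; congr 2; ring
  simp_rw [h]
  rw [integral_finsetSum _ fun i _ => integrable_phaseMeasure_of_continuous (by fun_prop)]
  simp_rw [integral_const_mul, integral_phaseExp_two_mul]
  rw [Finset.sum_eq_single j]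
  · simp
  · intro i _ hij
    have : ((i : ℕ) : ℤ) - (j : ℕ) ≠ 0 := by
      intro h; apply hij; ext; omega
    simp [this]
  · simp

/-- The Dirichlet kernel `∑_{i ≤ m} e^{i(2i-m)φ}` of `trigSpan m`. -/
def dirichletKernel (m : ℕ) (φ : ℝ) : ℂ := ∑ i : Fin (m + 1), phaseExp (2 * (i : ℕ) - m) φ

@[fun_prop] theorem continuous_dirichletKernel (m : ℕ) : Continuous (dirichletKernel m) := by
  unfold dirichletKernel; fun_prop

theorem norm_dirichletKernel_le (m : ℕ) (φ : ℝ) : ‖dirichletKernel m φ‖ ≤ m + 1 := by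
  refine (norm_sum_le _ _).trans ?_
  simp

theorem dirichletKernel_eq_neg (m : ℕ) (φ : ℝ) :
    dirichletKernel m φ = ∑ i : Fin (m + 1), phaseExp (-(2 * (i : ℕ) - m)) φ := by
  rw [dirichletKernel, ← Equiv.sum_comp Fin.revPerm]
  refine Finset.sum_congr rfl fun i _ => ?_
  congr 1
  simp only [Fin.revPerm_apply, Fin.val_rev]
  have := i.2
  omega

/-- Each term of the kernel extracts one Fourier coefficient, and the coefficients add up to the
value at `0`. -/
theorem integral_dirichletKernel_mul {m : ℕ} {g : ℝ → ℂ} (hg : g ∈ trigSpan m) :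
    ∫ φ, dirichletKernel m φ * g φ ∂phaseMeasure = g 0 := by
  obtain ⟨c, rfl⟩ := mem_trigSpan_iff.1 hg
  simp_rw [dirichletKernel_eq_neg, Finset.sum_mul]
  rw [integral_finsetSum _ fun i _ => integrable_phaseMeasure_of_continuous (by fun_prop)]
  simp only [phaseExp_zero_right, mul_one]
  refine Finset.sum_congr rfl fun j _ => ?_
  rw [← integral_mul_phaseExp_of_trig c j]
  refine integral_congr_ae (Eventually.of_forall fun φ => ?_)
  simp only [mul_comm]

theorem norm_coeff_le_of_trig {m : ℕ} (c : Fin (m + 1) → ℂ) (j : Fin (m + 1)) :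
    ‖c j‖ ≤ ∫ φ, ‖∑ i, c i * phaseExp (2 * (i : ℕ) - m) φ‖ ∂phaseMeasure := by
  conv_lhs => rw [← integral_mul_phaseExp_of_trig c j]
  refine (norm_integral_le_integral_norm _).trans (le_of_eq ?_)
  simp

/-- There are `m + 1` coefficients, each at most the `L¹` norm. This is the passage from phase
averages to individual phases. -/
theorem norm_le_of_mem_trigSpan {m : ℕ} {g : ℝ → ℂ} (hg : g ∈ trigSpan m) (θ : ℝ) :
    ‖g θ‖ ≤ (m + 1) * ∫ φ, ‖g φ‖ ∂phaseMeasure := by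
  obtain ⟨c, rfl⟩ := mem_trigSpan_iff.1 hg
  refine (norm_sum_le _ _).trans ?_
  have : ∀ i ∈ (Finset.univ : Finset (Fin (m + 1))), ‖c i * phaseExp (2 * (i : ℕ) - m) θ‖ ≤
      ∫ φ, ‖∑ i, c i * phaseExp (2 * (i : ℕ) - m) φ‖ ∂phaseMeasure := by
    intro i _
    rw [norm_mul, norm_phaseExp, mul_one]
    exact norm_coeff_le_of_trig c i
  refine (Finset.sum_le_card_nsmul _ _ _ this).trans (le_of_eq ?_)
  simp [nsmul_eq_mul]

/-! ### The Poisson kernel against trigonometric polynomials. -/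

theorem summable_pow_natAbs {ε : ℝ} (h0 : 0 ≤ ε) (h1 : ε < 1) :
    Summable fun n : ℤ => ε ^ n.natAbs := by
  refine Summable.of_nat_of_neg ?_ ?_ <;> simpa using summable_geometric_of_lt_one h0 h1

/-- The Poisson kernel `∑ n, ε^|n| e^{2inφ}`. -/
def poissonKernel (ε φ : ℝ) : ℂ := ∑' n : ℤ, (ε : ℂ) ^ n.natAbs * phaseExp (2 * n) φ

theorem poissonDelta_eq (ε φ : ℝ) : poissonDelta ε φ = (1 / Real.pi : ℂ) * poissonKernel ε φ := by
  simp only [poissonDelta, poissonKernel, phaseExp]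
  push_cast
  rfl

theorem norm_poissonTerm {ε : ℝ} (h0 : 0 ≤ ε) (n : ℤ) (φ : ℝ) :
    ‖(ε : ℂ) ^ n.natAbs * phaseExp (2 * n) φ‖ = ε ^ n.natAbs := by
  simp [abs_of_nonneg h0]

theorem continuous_poissonKernel {ε : ℝ} (h0 : 0 ≤ ε) (h1 : ε < 1) :
    Continuous (poissonKernel ε) :=
  continuous_tsum (fun n => by fun_prop) (summable_pow_natAbs h0 h1)
    fun n φ => (norm_poissonTerm h0 n φ).le

theorem norm_poissonKernel_le {ε : ℝ} (h0 : 0 ≤ ε) (h1 : ε < 1) (φ : ℝ) :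
    ‖poissonKernel ε φ‖ ≤ ∑' n : ℤ, ε ^ n.natAbs :=
  tsum_of_norm_bounded (summable_pow_natAbs h0 h1).hasSum fun n => (norm_poissonTerm h0 n φ).le

theorem integral_phaseExp_mul_poissonKernel {ε : ℝ} (h0 : 0 ≤ ε) (h1 : ε < 1) (j : ℤ) :
    ∫ φ, phaseExp (2 * j) φ * poissonKernel ε φ ∂phaseMeasure = (ε : ℂ) ^ j.natAbs := by
  have hs := hasSum_integral_of_summable_integral_norm (μ := phaseMeasure)
    (F := fun (n : ℤ) φ => phaseExp (2 * j) φ * ((ε : ℂ) ^ n.natAbs * phaseExp (2 * n) φ))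
    (fun n => integrable_phaseMeasure_of_continuous (by fun_prop)) (by
      simp only [norm_mul, norm_phaseExp, norm_pow, Complex.norm_real, Real.norm_eq_abs,
        abs_of_nonneg h0, mul_one, one_mul, integral_const, probReal_univ, one_smul]
      exact summable_pow_natAbs h0 h1)
  simp_rw [tsum_mul_left] at hs
  refine hs.unique ?_
  have h : ∀ n : ℤ, ∫ φ, phaseExp (2 * j) φ * ((ε : ℂ) ^ n.natAbs * phaseExp (2 * n) φ)
      ∂phaseMeasure = if n = -j then (ε : ℂ) ^ j.natAbs else 0 := by
    intro n
    have h' : ∀ φ, phaseExp (2 * j) φ * ((ε : ℂ) ^ n.natAbs * phaseExp (2 * n) φ) =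
        (ε : ℂ) ^ n.natAbs * phaseExp (2 * (j + n)) φ := by
      intro φ
      rw [mul_left_comm, phaseExp_mul]; congr 2; ring
    simp_rw [h']
    rw [integral_const_mul, integral_phaseExp_two_mul]
    by_cases hn : n = -j
    · subst hn; simp
    · rw [if_neg (by omega), if_neg hn, mul_zero]
  simp_rw [h]
  exact hasSum_ite_eq _ _

/-- The factor `e^{isφ}` shifts the frequencies `2i - (2k+s)` to the even ones `2(i-k)`, the only
ones the Poisson kernel sees diagonally. This is the role of the phase factor in the odd identity.
-/
theorem integral_poissonKernel_mul_trig {ε : ℝ} (h0 : 0 ≤ ε) (h1 : ε < 1) {k s : ℕ}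
    (c : Fin (2 * k + s + 1) → ℂ) :
    ∫ φ, phaseExp s φ * poissonKernel ε φ *
      (∑ i, c i * phaseExp (2 * (i : ℕ) - (2 * k + s : ℕ)) φ) ∂phaseMeasure =
      ∑ i, c i * (ε : ℂ) ^ (((i : ℕ) : ℤ) - k).natAbs := by
  have h : ∀ φ, phaseExp s φ * poissonKernel ε φ *
      (∑ i, c i * phaseExp (2 * (i : ℕ) - (2 * k + s : ℕ)) φ) =
      ∑ i, c i * (phaseExp (2 * (((i : ℕ) : ℤ) - k)) φ * poissonKernel ε φ) := by
    intro φ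
    rw [Finset.mul_sum]
    refine Finset.sum_congr rfl fun i _ => ?_
    have : phaseExp (2 * (((i : ℕ) : ℤ) - k)) φ =
        phaseExp s φ * phaseExp (2 * (i : ℕ) - (2 * k + s : ℕ)) φ := by
      rw [phaseExp_mul]; congr 1; push_cast; ring
    rw [this]; ring
  have hc := continuous_poissonKernel h0 h1
  simp_rw [h]
  rw [integral_finsetSum _ fun i _ => integrable_phaseMeasure_of_continuous (by fun_prop)]
  simp_rw [integral_const_mul, integral_phaseExp_mul_poissonKernel h0 h1]

theorem tendsto_integral_poissonKernel_mul {k s : ℕ} {g : ℝ → ℂ} (hg : g ∈ trigSpan (2 * k + s)) :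
    Tendsto (fun ε => ∫ φ, phaseExp s φ * poissonKernel ε φ * g φ ∂phaseMeasure) (𝓝[<] 1)
      (𝓝 (g 0)) := by
  obtain ⟨c, rfl⟩ := mem_trigSpan_iff.1 hg
  have h1 : Tendsto (fun ε : ℝ => ∑ i : Fin (2 * k + s + 1),
      c i * (ε : ℂ) ^ (((i : ℕ) : ℤ) - k).natAbs) (𝓝[<] 1) (𝓝 (∑ i, c i *
        ((1 : ℝ) : ℂ) ^ (((i : ℕ) : ℤ) - k).natAbs)) := by
    refine Tendsto.mono_left (Continuous.tendsto ?_ 1) nhdsWithin_le_nhds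
    fun_prop
  simp only [Complex.ofReal_one, one_pow, mul_one] at h1
  simp only [phaseExp_zero_right, mul_one]
  refine h1.congr' ?_
  filter_upwards [Ioo_mem_nhdsLT (show (0 : ℝ) < 1 by norm_num)] with ε hε
  exact (integral_poissonKernel_mul_trig hε.1.le hε.2 c).symm

/-- The bound does not depend on `ε`, since the kernel only multiplies coefficients by numbers in
`[0, 1]`; it serves as the dominating sequence in the limit `ε → 1⁻`. -/
theorem norm_integral_poissonKernel_mul_le {ε : ℝ} (h0 : 0 ≤ ε) (h1 : ε < 1) {k s : ℕ} {g : ℝ → ℂ}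
    (hg : g ∈ trigSpan (2 * k + s)) :
    ‖∫ φ, phaseExp s φ * poissonKernel ε φ * g φ ∂phaseMeasure‖ ≤
      ((2 * k + s : ℕ) + 1) * ∫ φ, ‖g φ‖ ∂phaseMeasure := by
  obtain ⟨c, hc⟩ := mem_trigSpan_iff.1 hg
  have hci : ∀ i, ‖c i‖ ≤ ∫ φ, ‖g φ‖ ∂phaseMeasure := by
    intro i
    rw [hc]
    exact norm_coeff_le_of_trig c i
  rw [hc, integral_poissonKernel_mul_trig h0 h1, ← hc]
  refine (norm_sum_le _ _).trans ?_
  have : ∀ i ∈ (Finset.univ : Finset (Fin (2 * k + s + 1))),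
      ‖c i * (ε : ℂ) ^ (((i : ℕ) : ℤ) - k).natAbs‖ ≤ ∫ φ, ‖g φ‖ ∂phaseMeasure := by
    intro i _
    rw [norm_mul, norm_pow, Complex.norm_real, Real.norm_eq_abs, abs_of_nonneg h0]
    exact (mul_le_of_le_one_right (norm_nonneg _) (pow_le_one₀ h0 h1.le)).trans (hci i)
  refine (Finset.sum_le_card_nsmul _ _ _ this).trans (le_of_eq ?_)
  simp [nsmul_eq_mul]

/-! ### The outcome measures as a Markov kernel -/

theorem enorm_sq_eq_lintegral {μ : Measure ℝ} (f : Lp ℂ 2 μ) :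
    ‖f‖ₑ ^ 2 = ∫⁻ x, ‖f x‖ₑ ^ 2 ∂μ := by
  rw [Lp.enorm_def, eLpNorm_eq_lintegral_rpow_enorm_toReal (by norm_num) (by norm_num)]
  rw [← ENNReal.rpow_natCast, ← ENNReal.rpow_mul]
  simp

theorem hasSum_quadratureRep (φ : ℝ) (ψ : Fock) :
    HasSum (fun n : ℕ => (ψ n * phaseExp (-n) φ) • numberL2 n) (quadratureRep φ ψ) := by
  have h := (quadratureBasis φ).hasSum_repr_symm ψ
  refine h.congr_fun ?_
  intro n
  simp only [quadratureBasis, HilbertBasis.coe_mkOfOrthogonalEqBot, smul_smul, phaseExp]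
  congr 3
  push_cast; ring

/-- The restriction of a wave function to a set of outcomes. -/
abbrev restrictL2 (B : Set ℝ) :
    Lp ℂ 2 (volume : Measure ℝ) →L[ℂ] Lp ℂ 2 ((volume : Measure ℝ).restrict B) :=
  LpToLpRestrictCLM ℝ ℂ ℂ volume 2 B

theorem enorm_restrictL2_sq {B : Set ℝ} (f : Lp ℂ 2 (volume : Measure ℝ)) :
    ‖restrictL2 B f‖ₑ ^ 2 = ∫⁻ x in B, ‖f x‖ₑ ^ 2 := by
  rw [enorm_sq_eq_lintegral]
  refine lintegral_congr_ae ?_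
  filter_upwards [LpToLpRestrictCLM_coeFn ℂ B f] with x hx
  rw [hx]

/-- The outcome measure of the single vector `ψ`. -/
def vecOutcome (ψ : Fock) (φ : ℝ) : Measure ℝ :=
  (volume : Measure ℝ).withDensity fun x => ‖quadratureRep φ ψ x‖ₑ ^ 2

theorem outcome_eq_sum (ρ : State) (φ : ℝ) :
    ρ.outcome φ = Measure.sum fun j => vecOutcome (ρ.vec j) φ := rfl

theorem vecOutcome_apply (ψ : Fock) (φ : ℝ) {B : Set ℝ} (hB : MeasurableSet B) :
    vecOutcome ψ φ B = ‖restrictL2 B (quadratureRep φ ψ)‖ₑ ^ 2 := by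
  rw [vecOutcome, withDensity_apply _ hB, enorm_restrictL2_sq]

theorem hasSum_restrictL2 (B : Set ℝ) (φ : ℝ) (ψ : Fock) :
    HasSum (fun n : ℕ => (ψ n * phaseExp (-n) φ) • restrictL2 B (numberL2 n))
      (restrictL2 B (quadratureRep φ ψ)) := by
  have := (restrictL2 B).hasSum (hasSum_quadratureRep φ ψ)
  simpa only [Function.comp_def, map_smul] using this

theorem tendsto_enorm_restrictL2 (B : Set ℝ) (φ : ℝ) (ψ : Fock) :
    Tendsto (fun N => ‖∑ n ∈ Finset.range N,
      (ψ n * phaseExp (-n) φ) • restrictL2 B (numberL2 n)‖ₑ ^ 2) atTop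
      (𝓝 (‖restrictL2 B (quadratureRep φ ψ)‖ₑ ^ 2)) :=
  ((ENNReal.continuous_pow 2).tendsto _).comp
    ((continuous_enorm.tendsto _).comp (hasSum_restrictL2 B φ ψ).tendsto_sum_nat)

/-- For a fixed set of outcomes, the probability is a pointwise limit of continuous functions of the
phase, obtained by truncating the number-state expansion. -/
theorem measurable_vecOutcome (ψ : Fock) : Measurable (vecOutcome ψ) := by
  refine Measure.measurable_of_measurable_coe _ fun B hB => ?_
  simp_rw [vecOutcome_apply ψ _ hB]
  refine measurable_of_tendsto_metrizable (f := fun N φ => ‖∑ n ∈ Finset.range N,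
      (ψ n * phaseExp (-n) φ) • restrictL2 B (numberL2 n)‖ₑ ^ 2) (fun N => ?_) ?_
  · refine Continuous.measurable ?_
    refine (ENNReal.continuous_pow 2).comp (continuous_enorm.comp ?_)
    fun_prop
  · rw [tendsto_pi_nhds]
    exact fun φ => tendsto_enorm_restrictL2 B φ ψ

theorem vecOutcome_univ (ψ : Fock) (φ : ℝ) : vecOutcome ψ φ Set.univ = ‖ψ‖ₑ ^ 2 := by
  rw [vecOutcome, withDensity_apply _ MeasurableSet.univ, Measure.restrict_univ,
    ← enorm_sq_eq_lintegral, LinearIsometryEquiv.enorm_map]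

theorem measurable_outcome (ρ : State) : Measurable ρ.outcome := by
  refine Measure.measurable_of_measurable_coe _ fun B hB => ?_
  simp_rw [outcome_eq_sum, Measure.sum_apply _ hB]
  exact Measurable.tsum fun j => (Measure.measurable_coe hB).comp (measurable_vecOutcome _)

/-- The outcome distributions as a kernel from phases to outcomes. -/
def State.kernel (ρ : State) : ProbabilityTheory.Kernel ℝ ℝ := ⟨ρ.outcome, measurable_outcome ρ⟩

theorem State.kernel_apply (ρ : State) (φ : ℝ) : ρ.kernel φ = ρ.outcome φ := rfl

theorem State.tsum_enorm_sq (ρ : State) : ∑' j, ‖ρ.vec j‖ₑ ^ 2 = 1 := by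
  have h := ρ.hasSum_norm_sq
  have h2 := ENNReal.ofReal_tsum_of_nonneg (f := fun j => ‖ρ.vec j‖ ^ 2) (fun j => by positivity)
    h.summable
  rw [h.tsum_eq, ENNReal.ofReal_one] at h2
  rw [h2]
  refine tsum_congr fun j => ?_
  rw [ENNReal.ofReal_pow (norm_nonneg _), ofReal_norm]

instance (ρ : State) (φ : ℝ) : IsProbabilityMeasure (ρ.outcome φ) := by
  constructor
  simp_rw [outcome_eq_sum, Measure.sum_apply _ MeasurableSet.univ, vecOutcome_univ]
  exact ρ.tsum_enorm_sq

instance (ρ : State) : ProbabilityTheory.IsMarkovKernel ρ.kernel :=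
  ⟨fun φ => by rw [ρ.kernel_apply]; infer_instance⟩

/-! ### Phase average of the outcome measures -/

theorem eval_neg_hermiteR (n : ℕ) (x : ℝ) :
    (hermiteR n).eval (-x) = (-1) ^ n * (hermiteR n).eval x := by
  induction n using Nat.twoStepInduction with
  | zero => simp [hermiteR_zero]
  | one => simp [hermiteR_succ, hermiteR_zero]
  | more n h0 h1 =>
    have key : ∀ y, (hermiteR (n + 2)).eval y =
        y * (hermiteR (n + 1)).eval y - (n + 1) * (hermiteR n).eval y := by
      intro y
      have h := congrArg (eval y) (hermiteR_recurrence n)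
      simp only [eval_mul, eval_X, eval_add, eval_natCast, eval_one] at h
      linarith
    rw [key, key, h0, h1]; ring

theorem numberFn_neg (n : ℕ) (x : ℝ) : numberFn n (-x) = (-1) ^ n * numberFn n x := by
  simp only [numberFn, mul_neg, eval_neg_hermiteR, neg_sq]; ring

theorem coeFn_numberL2 (n : ℕ) : numberL2 n =ᵐ[volume] fun x => (numberFn n x : ℂ) :=
  (memLp_numberFn n).coeFn_toLp

/-- The product of two number-state wave functions of opposite parity is odd, and the set is
symmetric. -/
theorem inner_restrictL2_numberL2 {B : Set ℝ} (hB : MeasurableSet B) (hs : ∀ x, -x ∈ B ↔ x ∈ B)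
    {n m : ℕ} (hnm : Odd (n + m)) :
    inner ℂ (restrictL2 B (numberL2 n)) (restrictL2 B (numberL2 m)) = 0 := by
  rw [L2.inner_def]
  have h1 : ∀ᵐ x ∂(volume.restrict B), inner ℂ (restrictL2 B (numberL2 n) x)
      (restrictL2 B (numberL2 m) x) = ((numberFn n x * numberFn m x : ℝ) : ℂ) := by
    filter_upwards [LpToLpRestrictCLM_coeFn ℂ B (numberL2 n),
      LpToLpRestrictCLM_coeFn ℂ B (numberL2 m), ae_restrict_of_ae (coeFn_numberL2 n),
      ae_restrict_of_ae (coeFn_numberL2 m)] with x e1 e2 e3 e4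
    rw [e1, e2, e3, e4]
    simp [mul_comm]
  rw [integral_congr_ae h1, ← integral_indicator hB]
  set F : ℝ → ℂ := B.indicator fun x => ((numberFn n x * numberFn m x : ℝ) : ℂ)
  have hF : ∀ x, F (-x) = -F x := by
    intro x
    by_cases hx : x ∈ B
    · simp only [F, Set.indicator_of_mem hx, Set.indicator_of_mem ((hs x).2 hx), numberFn_neg]
      rw [mul_mul_mul_comm, ← pow_add, hnm.neg_one_pow]; simp
    · simp only [F, Set.indicator_of_notMem hx, Set.indicator_of_notMem (mt (hs x).1 hx), neg_zero]
  have h2 := integral_neg_eq_self F volume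
  simp_rw [hF] at h2
  rw [integral_neg] at h2
  exact self_eq_neg.1 h2.symm

/-- Off the diagonal, a cross term of frequency `n - m` integrates to zero over `[0, π)` when `n -
m` is even; when it is odd, `hv` removes the term. -/
theorem lintegral_enorm_sq_sum_phase {E : Type*} [NormedAddCommGroup E] [InnerProductSpace ℂ E]
    {v : ℕ → E} (hv : ∀ n m, Odd (n + m) → inner ℂ (v n) (v m) = 0) (c : ℕ → ℂ) (N : ℕ) :
    ∫⁻ φ, ‖∑ n ∈ Finset.range N, (c n * phaseExp (-n) φ) • v n‖ₑ ^ 2 ∂phaseMeasure =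
      ∑ n ∈ Finset.range N, ‖c n‖ₑ ^ 2 * ‖v n‖ₑ ^ 2 := by
  have h1 : ∀ φ, ((‖∑ n ∈ Finset.range N, (c n * phaseExp (-n) φ) • v n‖ ^ 2 : ℝ) : ℂ) =
      ∑ n ∈ Finset.range N, ∑ m ∈ Finset.range N,
        (starRingEnd ℂ (c n) * c m * inner ℂ (v n) (v m)) * phaseExp (n - m) φ := by
    intro φ
    have := inner_self_eq_norm_sq_to_K (𝕜 := ℂ) (∑ n ∈ Finset.range N, (c n * phaseExp (-n) φ) • v n)
    push_cast
    rw [← Complex.coe_algebraMap, ← this]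
    simp only [sum_inner, inner_sum, inner_smul_left, inner_smul_right, map_mul, conj_phaseExp,
      Finset.mul_sum]
    rw [Finset.sum_comm]
    refine Finset.sum_congr rfl fun n _ => Finset.sum_congr rfl fun m _ => ?_
    have : phaseExp (n - m) φ = phaseExp (- -n) φ * phaseExp (-m) φ := by
      rw [phaseExp_mul]; congr 1; ring
    rw [this]; ring
  have hc : Continuous fun φ => ‖∑ n ∈ Finset.range N, (c n * phaseExp (-n) φ) • v n‖ ^ 2 := by
    fun_prop
  have h2 : ∫ φ, ‖∑ n ∈ Finset.range N, (c n * phaseExp (-n) φ) • v n‖ ^ 2 ∂phaseMeasure =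
      ∑ n ∈ Finset.range N, ‖c n‖ ^ 2 * ‖v n‖ ^ 2 := by
    rw [← Complex.ofReal_inj, ← integral_complex_ofReal]
    simp_rw [h1]
    rw [integral_finsetSum _ fun i _ => integrable_phaseMeasure_of_continuous (by fun_prop)]
    push_cast
    refine Finset.sum_congr rfl fun n hn => ?_
    rw [integral_finsetSum _ fun i _ => integrable_phaseMeasure_of_continuous (by fun_prop)]
    simp_rw [integral_const_mul]
    rw [Finset.sum_eq_single n]
    · simp only [sub_self, phaseExp_zero_left, integral_const, probReal_univ, one_smul, mul_one]
      rw [inner_self_eq_norm_sq_to_K, Complex.conj_mul']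
      simp
    · intro m _ hmn
      rcases Nat.even_or_odd (n + m) with he | ho
      · obtain ⟨r, hr⟩ : ∃ r : ℤ, (n : ℤ) - m = 2 * r := by
          obtain ⟨q, hq⟩ := he
          exact ⟨q - m, by omega⟩
        rw [hr, integral_phaseExp_two_mul, if_neg (by omega), mul_zero]
      · rw [hv n m ho]; simp
    · intro h; exact absurd hn h
  have h3 : ∀ φ, ‖∑ n ∈ Finset.range N, (c n * phaseExp (-n) φ) • v n‖ₑ ^ 2 =
      ENNReal.ofReal (‖∑ n ∈ Finset.range N, (c n * phaseExp (-n) φ) • v n‖ ^ 2) := by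
    intro φ
    rw [ENNReal.ofReal_pow (norm_nonneg _), ofReal_norm]
  simp_rw [h3]
  have hi : Integrable (fun φ => ‖∑ n ∈ Finset.range N, (c n * phaseExp (-n) φ) • v n‖ ^ 2)
      phaseMeasure := integrable_phaseMeasure_of_continuous hc
  rw [← ofReal_integral_eq_lintegral_ofReal hi (Eventually.of_forall fun φ => by positivity), h2,
    ENNReal.ofReal_sum_of_nonneg fun _ _ => by positivity]
  refine Finset.sum_congr rfl fun n _ => ?_
  rw [ENNReal.ofReal_mul (by positivity), ENNReal.ofReal_pow (norm_nonneg _),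
    ENNReal.ofReal_pow (norm_nonneg _), ofReal_norm, ofReal_norm]

/-- Bessel's inequality, giving a dominating constant independent of the phase and of the
truncation. -/
theorem norm_sum_numberL2_le (ψ : Fock) (φ : ℝ) (N : ℕ) :
    ‖∑ n ∈ Finset.range N, (ψ n * phaseExp (-n) φ) • numberL2 n‖ ≤ ‖ψ‖ := by
  refine le_of_sq_le_sq ?_ (norm_nonneg _)
  have h1 : ‖∑ n ∈ Finset.range N, (ψ n * phaseExp (-n) φ) • numberL2 n‖ ^ 2 =
      ∑ n ∈ Finset.range N, ‖ψ n‖ ^ 2 := by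
    rw [← Complex.ofReal_inj]
    push_cast
    rw [← Complex.coe_algebraMap, ← inner_self_eq_norm_sq_to_K (𝕜 := ℂ),
      orthonormal_numberL2.inner_sum]
    refine Finset.sum_congr rfl fun n _ => ?_
    rw [Complex.conj_mul']
    simp
  rw [h1]
  have := lp.sum_rpow_le_norm_rpow (p := 2) (by norm_num) ψ (Finset.range N)
  simpa using this

theorem lintegral_vecOutcome_apply (ψ : Fock) {B : Set ℝ} (hB : MeasurableSet B)
    (hs : ∀ x, -x ∈ B ↔ x ∈ B) :
    ∫⁻ φ, vecOutcome ψ φ B ∂phaseMeasure =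
      ∑' n, ‖ψ n‖ₑ ^ 2 * ∫⁻ x in B, ‖numberL2 n x‖ₑ ^ 2 := by
  simp_rw [vecOutcome_apply ψ _ hB]
  refine tendsto_nhds_unique (f := fun N => ∫⁻ φ, ‖∑ n ∈ Finset.range N,
      (ψ n * phaseExp (-n) φ) • restrictL2 B (numberL2 n)‖ₑ ^ 2 ∂phaseMeasure) (l := atTop) ?_ ?_
  · refine tendsto_lintegral_of_dominated_convergence
      (fun _ => (‖restrictL2 B‖ₑ * ‖ψ‖ₑ) ^ 2) (fun N => ?_) (fun N => ?_) ?_ ?_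
    · refine Continuous.measurable ?_
      refine (ENNReal.continuous_pow 2).comp (continuous_enorm.comp ?_)
      fun_prop
    · refine Eventually.of_forall fun φ => ?_
      have h1 : ∑ n ∈ Finset.range N, (ψ n * phaseExp (-n) φ) • restrictL2 B (numberL2 n) =
          restrictL2 B (∑ n ∈ Finset.range N, (ψ n * phaseExp (-n) φ) • numberL2 n) := by
        simp only [map_sum, map_smul]
      simp only [h1]
      gcongr
      refine ((restrictL2 B).le_opENorm _).trans ?_
      gcongr
      rw [← ofReal_norm, ← ofReal_norm]
      exact ENNReal.ofReal_le_ofReal (norm_sum_numberL2_le ψ φ N)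
    · simp only [lintegral_const, measure_univ, mul_one]
      exact ENNReal.pow_ne_top (ENNReal.mul_ne_top enorm_ne_top enorm_ne_top)
    · exact Eventually.of_forall fun φ => tendsto_enorm_restrictL2 B φ ψ
  · simp_rw [lintegral_enorm_sq_sum_phase
      (fun n m hnm => inner_restrictL2_numberL2 hB hs hnm) (fun n => ψ n), enorm_restrictL2_sq]
    exact ENNReal.summable.hasSum.tendsto_sum_nat

/-- Even moments depend only on the law of `x²`, and preimages under squaring are symmetric sets,
for which the averaged probabilities are already known. Comparing image measures under `x ↦ x²`
avoids any integrability assumption. -/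
theorem lintegral_vecOutcome_moment (ψ : Fock) (k : ℕ) :
    ∫⁻ φ, ∫⁻ x, ‖x‖ₑ ^ (2 * k) ∂(vecOutcome ψ φ) ∂phaseMeasure =
      ∑' n, ‖ψ n‖ₑ ^ 2 * ∫⁻ x, ‖x‖ₑ ^ (2 * k) * ‖numberL2 n x‖ₑ ^ 2 := by
  set μ₁ : Measure ℝ := phaseMeasure.bind (vecOutcome ψ) with hμ₁
  have hd : ∀ n, Measurable fun x => ‖numberL2 n x‖ₑ ^ 2 := fun n =>
    ((Lp.stronglyMeasurable _).measurable.enorm).pow_const 2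
  set μ₂ : Measure ℝ := Measure.sum fun n => ‖ψ n‖ₑ ^ 2 •
    (volume : Measure ℝ).withDensity (fun x => ‖numberL2 n x‖ₑ ^ 2) with hμ₂
  have hsq : Measurable fun x : ℝ => x ^ 2 := by fun_prop
  have hmap : μ₁.map (fun x => x ^ 2) = μ₂.map (fun x => x ^ 2) := by
    ext B hB
    rw [Measure.map_apply hsq hB, Measure.map_apply hsq hB]
    have hB' := hsq hB
    rw [hμ₁, Measure.bind_apply hB' (measurable_vecOutcome ψ).aemeasurable,
      lintegral_vecOutcome_apply ψ hB' (by simp), hμ₂, Measure.sum_apply _ hB']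
    refine tsum_congr fun n => ?_
    rw [Measure.smul_apply, withDensity_apply _ hB', smul_eq_mul]
  have hpow : Measurable fun y : ℝ => ‖y‖ₑ ^ k := by fun_prop
  have hx : ∀ x : ℝ, ‖x‖ₑ ^ (2 * k) = ‖x ^ 2‖ₑ ^ k := by
    intro x; rw [enorm_pow, pow_mul]
  have h1 : ∫⁻ x, ‖x‖ₑ ^ (2 * k) ∂μ₁ = ∫⁻ x, ‖x‖ₑ ^ (2 * k) ∂μ₂ := by
    simp_rw [hx]
    rw [← lintegral_map (f := fun y => ‖y‖ₑ ^ k) hpow hsq, hmap, lintegral_map hpow hsq]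
  have hm : Measurable fun x : ℝ => ‖x‖ₑ ^ (2 * k) := by fun_prop
  rw [hμ₁, Measure.lintegral_bind (measurable_vecOutcome ψ).aemeasurable hm.aemeasurable, hμ₂,
    lintegral_sum_measure] at h1
  rw [h1]
  refine tsum_congr fun n => ?_
  rw [lintegral_smul_measure, lintegral_withDensity_eq_lintegral_mul _ (hd n) hm, smul_eq_mul]
  congr 1
  exact lintegral_congr fun x => by rw [Pi.mul_apply, mul_comm]

/-! ### Position moments of number states -/

/-- The matrix element `⟨n|X_0^m|n'⟩`. -/
def matrixElement (m n n' : ℕ) : ℝ := ∫ x, x ^ m * (numberFn n x * numberFn n' x)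

theorem integrable_pow_mul_numberFn (m n n' : ℕ) :
    Integrable fun x : ℝ => x ^ m * (numberFn n x * numberFn n' x) := by
  refine (integrable_poly_gauss (X ^ m * (C (√(√(2 / Real.pi) / (n.factorial : ℝ)) *
    √(√(2 / Real.pi) / (n'.factorial : ℝ))) * ((hermiteR n * hermiteR n').comp (C 2 * X))))
    (b := 2) (by norm_num)).congr (Eventually.of_forall fun x => ?_)
  simp only [numberFn_mul_eq, eval_mul (p := X ^ m), eval_pow, eval_X, mul_assoc]

theorem matrixElement_succ (m n n' : ℕ) : 2 * matrixElement (m + 1) n n' =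
    √((n : ℝ) + 1) * matrixElement m (n + 1) n' + √(n : ℝ) * matrixElement m (n - 1) n' := by
  simp only [matrixElement]
  rw [← integral_const_mul, ← integral_const_mul, ← integral_const_mul,
    ← integral_add ((integrable_pow_mul_numberFn _ _ _).const_mul _)
      ((integrable_pow_mul_numberFn _ _ _).const_mul _)]
  refine integral_congr_ae (Eventually.of_forall fun x => ?_)
  simp only
  linear_combination x ^ m * numberFn n' x * numberFn_recurrence n x

/-- Each factor `X_0` moves the number index by exactly one, so `m` factors move it by at most `m`,
with the parity of `m`. -/
theorem band_of_matrixElement_ne_zero {m n n' : ℕ} (h : matrixElement m n n' ≠ 0) :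
    |(n : ℤ) - n'| ≤ m ∧ Even ((n : ℤ) - n' + m) := by
  induction m generalizing n with
  | zero =>
    have : n = n' := by
      by_contra hn
      apply h
      simp only [matrixElement, pow_zero, one_mul, integral_numberFn_mul, if_neg hn]
    subst this; simp
  | succ m ih =>
    have h2 := matrixElement_succ m n n'
    by_cases h3 : matrixElement m (n + 1) n' = 0
    · have h4 : √(n : ℝ) * matrixElement m (n - 1) n' ≠ 0 := by
        intro h5
        rw [h3, h5] at h2
        apply h
        linarith
      -- The lowering term carries `√n`, which vanishes at `n = 0`; hence `n - 1` is a genuine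
      -- predecessor here.
      have hn : n ≠ 0 := by
        rintro rfl; simp at h4
      obtain ⟨h5, r, hr⟩ := ih (right_ne_zero_of_mul h4)
      rw [abs_le] at h5 ⊢
      exact ⟨by omega, r + 1, by omega⟩
    · obtain ⟨h5, r, hr⟩ := ih h3
      rw [abs_le] at h5 ⊢
      exact ⟨by omega, r, by omega⟩

theorem memLp_pow_mul_numberFn (a n : ℕ) :
    MemLp (fun x : ℝ => ((x ^ a * numberFn n x : ℝ) : ℂ)) 2 volume := by
  refine (memLp_poly (C (√(√(2 / Real.pi) / (n.factorial : ℝ))) * (C (1 / 2) * X) ^ a *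
    hermiteR n)).ae_eq (Eventually.of_forall fun x => ?_)
  simp only [numberFn, eval_mul, eval_C, eval_pow, eval_X]
  rw [show (1 / 2 : ℝ) * (2 * x) = x by ring]
  congr 1; ring

/-- The vector `x^a u_n` of `L²(ℝ)`. -/
def powNumberL2 (a n : ℕ) : Lp ℂ 2 (volume : Measure ℝ) := (memLp_pow_mul_numberFn a n).toLp _

theorem coeFn_powNumberL2 (a n : ℕ) :
    powNumberL2 a n =ᵐ[volume] fun x : ℝ => ((x ^ a * numberFn n x : ℝ) : ℂ) :=
  (memLp_pow_mul_numberFn a n).coeFn_toLp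

theorem inner_powNumberL2 (a b n n' : ℕ) :
    inner ℂ (powNumberL2 a n) (powNumberL2 b n') = (matrixElement (a + b) n n' : ℂ) := by
  rw [L2.inner_def, matrixElement, ← integral_complex_ofReal]
  refine integral_congr_ae ?_
  filter_upwards [coeFn_powNumberL2 a n, coeFn_powNumberL2 b n'] with x h1 h2
  rw [h1, h2, RCLike.inner_apply, Complex.conj_ofReal, ← Complex.ofReal_mul]
  congr 1; ring

theorem enorm_powNumberL2_sq (a n : ℕ) :
    ‖powNumberL2 a n‖ₑ ^ 2 = ∫⁻ x, ‖x‖ₑ ^ (2 * a) * ‖numberL2 n x‖ₑ ^ 2 := by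
  rw [enorm_sq_eq_lintegral]
  refine lintegral_congr_ae ?_
  filter_upwards [coeFn_powNumberL2 a n, coeFn_numberL2 n] with x h1 h2
  rw [h1, h2]
  push_cast
  rw [enorm_mul, enorm_pow, mul_pow, ← pow_mul, mul_comm a 2]
  congr 2
  simp [enorm_eq_nnnorm]

/-! ### Almost orthogonal series -/

/-- Schur's test: a row of the Gram matrix has at most `2L + 1` nonzero entries, and `2 Re⟨u, v⟩ ≤
‖u‖² + ‖v‖²` distributes each entry over its two diagonal terms. -/
theorem norm_sum_sq_le_of_band {E : Type*} [NormedAddCommGroup E] [InnerProductSpace ℂ E]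
    {y : ℕ → E} {L : ℕ} (hy : ∀ n m : ℕ, (L : ℤ) < |(n : ℤ) - m| → inner ℂ (y n) (y m) = 0)
    (t : Finset ℕ) : ‖∑ n ∈ t, y n‖ ^ 2 ≤ (2 * L + 1) * ∑ n ∈ t, ‖y n‖ ^ 2 := by
  let χ : ℕ → ℕ → ℝ := fun n m => if |(n : ℤ) - m| ≤ L then 1 else 0
  have hχs : ∀ n m, χ n m = χ m n := fun n m => by simp only [χ, abs_sub_comm]
  have hrow : ∀ n, ∑ m ∈ t, χ n m ≤ 2 * L + 1 := by
    intro n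
    simp only [χ, Finset.sum_boole]
    have h1 : (t.filter fun m : ℕ => |(n : ℤ) - m| ≤ L) ⊆ Finset.Icc (n - L) (n + L) := by
      intro m hm
      have := (Finset.mem_filter.1 hm).2
      rw [abs_le] at this
      rw [Finset.mem_Icc]; omega
    have h2 := Finset.card_le_card h1
    rw [Nat.card_Icc] at h2
    have h3 : (t.filter fun m : ℕ => |(n : ℤ) - m| ≤ L).card ≤ 2 * L + 1 := by omega
    exact_mod_cast h3
  have h1 : ‖∑ n ∈ t, y n‖ ^ 2 = ∑ n ∈ t, ∑ m ∈ t, (inner ℂ (y n) (y m)).re := by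
    rw [← inner_self_eq_norm_sq (𝕜 := ℂ), sum_inner]
    simp only [inner_sum, map_sum]
    rfl
  have h2 : ∀ n m, (inner ℂ (y n) (y m)).re ≤
      1 / 2 * (χ n m * ‖y n‖ ^ 2) + 1 / 2 * (χ m n * ‖y m‖ ^ 2) := by
    intro n m
    by_cases h : |(n : ℤ) - m| ≤ L
    · have h' : |(m : ℤ) - n| ≤ L := by rwa [abs_sub_comm]
      have := (Complex.re_le_norm _).trans (norm_inner_le_norm (𝕜 := ℂ) (y n) (y m))
      simp only [χ, if_pos h, if_pos h', one_mul]
      nlinarith [sq_nonneg (‖y n‖ - ‖y m‖)]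
    · have h' : ¬ |(m : ℤ) - n| ≤ L := by rwa [abs_sub_comm]
      rw [hy n m (not_le.1 h)]
      simp [χ, if_neg h, if_neg h']
  have h3 : ∑ n ∈ t, ∑ m ∈ t, χ n m * ‖y n‖ ^ 2 ≤ (2 * L + 1) * ∑ n ∈ t, ‖y n‖ ^ 2 := by
    rw [Finset.mul_sum]
    refine Finset.sum_le_sum fun n _ => ?_
    rw [← Finset.sum_mul]
    exact mul_le_mul_of_nonneg_right (hrow n) (by positivity)
  rw [h1]
  calc _ ≤ ∑ n ∈ t, ∑ m ∈ t, (1 / 2 * (χ n m * ‖y n‖ ^ 2) + 1 / 2 * (χ m n * ‖y m‖ ^ 2)) :=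
        Finset.sum_le_sum fun n _ => Finset.sum_le_sum fun m _ => h2 n m
    _ = ∑ n ∈ t, ∑ m ∈ t, χ n m * ‖y n‖ ^ 2 := by
        simp only [Finset.sum_add_distrib, ← Finset.mul_sum]
        rw [Finset.sum_comm (f := fun n m => χ m n * ‖y m‖ ^ 2)]
        ring
    _ ≤ _ := h3

theorem summable_of_band {E : Type*} [NormedAddCommGroup E] [InnerProductSpace ℂ E]
    [CompleteSpace E] {y : ℕ → E} {L : ℕ}
    (hy : ∀ n m : ℕ, (L : ℤ) < |(n : ℤ) - m| → inner ℂ (y n) (y m) = 0)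
    (hs : Summable fun n => ‖y n‖ ^ 2) : Summable y := by
  rw [summable_iff_vanishing_norm] at hs ⊢
  intro ε hε
  obtain ⟨s, hs⟩ := hs (ε ^ 2 / (2 * L + 1)) (by positivity)
  refine ⟨s, fun t ht => ?_⟩
  have h1 := hs t ht
  rw [Real.norm_of_nonneg (by positivity), lt_div_iff₀ (by positivity)] at h1
  refine lt_of_pow_lt_pow_left₀ 2 hε.le ?_
  calc _ ≤ _ := norm_sum_sq_le_of_band hy t
    _ < _ := by linarith

/-! ### Moments of a single vector -/

/-- The phase averaged moment `∫ dφ/π ⟨X_φ^{2k}⟩` of a single vector. -/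
def vecMoment (ψ : Fock) (k : ℕ) : ℝ≥0∞ :=
  ∫⁻ φ, ∫⁻ x, ‖x‖ₑ ^ (2 * k) ∂(vecOutcome ψ φ) ∂phaseMeasure

theorem enorm_pow_le_one_add {m l : ℕ} (h : m ≤ l) (x : ℝ) : ‖x‖ₑ ^ m ≤ 1 + ‖x‖ₑ ^ l := by
  rcases le_total ‖x‖ₑ 1 with h1 | h1
  · exact (pow_le_one' h1 m).trans le_self_add
  · exact (pow_le_pow_right' h1 h).trans le_add_self

theorem vecMoment_ne_top_of_le {ψ : Fock} {a k : ℕ} (hak : a ≤ k) (h : vecMoment ψ k ≠ ⊤) :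
    vecMoment ψ a ≠ ⊤ := by
  refine ne_top_of_le_ne_top (b := ‖ψ‖ₑ ^ 2 + vecMoment ψ k)
    (ENNReal.add_ne_top.2 ⟨ENNReal.pow_ne_top enorm_ne_top, h⟩) ?_
  calc vecMoment ψ a ≤ ∫⁻ φ, (‖ψ‖ₑ ^ 2 + ∫⁻ x, ‖x‖ₑ ^ (2 * k) ∂(vecOutcome ψ φ)) ∂phaseMeasure := by
        refine lintegral_mono fun φ => ?_
        rw [← vecOutcome_univ ψ φ, ← lintegral_one, ← lintegral_add_left (by fun_prop)]
        exact lintegral_mono fun x => enorm_pow_le_one_add (by omega) x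
    _ = _ := by
        rw [lintegral_add_left (by fun_prop)]
        simp [vecMoment]

/-- The averaged moment is the sum of the squared norms of these vectors, and they are banded with
width `2a`. Finiteness of an average over phases thus yields convergence at every phase, with no
exceptional set. -/
theorem summable_pow_quadratureRep {ψ : Fock} {a : ℕ} (h : vecMoment ψ a ≠ ⊤) (φ : ℝ) :
    Summable fun n : ℕ => (ψ n * phaseExp (-n) φ) • powNumberL2 a n := by
  refine summable_of_band (L := 2 * a) (fun n m hnm => ?_) ?_
  · rw [inner_smul_left, inner_smul_right, inner_powNumberL2]
    have : matrixElement (a + a) n m = 0 := by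
      by_contra h1
      have := (band_of_matrixElement_ne_zero h1).1
      push_cast at this hnm
      omega
    rw [this]; simp
  · rw [vecMoment, lintegral_vecOutcome_moment] at h
    simp_rw [← enorm_powNumberL2_sq] at h
    have := ENNReal.summable_toReal h
    refine this.congr fun n => ?_
    simp [norm_smul, mul_pow, ENNReal.toReal_mul]

/-- Multiplication by `x^a` is unbounded, so it cannot be applied to the `L²` limit directly; both
series are compared almost everywhere along a common subsequence of partial sums. -/
theorem coeFn_pow_quadratureRep {ψ : Fock} {a : ℕ} (h : vecMoment ψ a ≠ ⊤) (φ : ℝ) :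
    (∑' n : ℕ, (ψ n * phaseExp (-n) φ) • powNumberL2 a n : Lp ℂ 2 (volume : Measure ℝ))
      =ᵐ[volume] fun x : ℝ => (x : ℂ) ^ a * quadratureRep φ ψ x := by
  set c : ℕ → ℂ := fun n => ψ n * phaseExp (-n) φ with hc
  have h1 := (summable_pow_quadratureRep h φ).hasSum.tendsto_sum_nat
  have h2 := (hasSum_quadratureRep φ ψ).tendsto_sum_nat
  obtain ⟨ns, hns, h3⟩ := (tendstoInMeasure_of_tendsto_Lp h1).exists_seq_tendsto_ae
  -- The second subsequence is extracted from the first, so that both series converge almost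
  -- everywhere along `ns ∘ ms`.
  obtain ⟨ms, hms, h4⟩ := (tendstoInMeasure_of_tendsto_Lp
    (h2.comp hns.tendsto_atTop)).exists_seq_tendsto_ae
  have h5 : ∀ N, (∑ n ∈ Finset.range N, c n • powNumberL2 a n : Lp ℂ 2 (volume : Measure ℝ))
      =ᵐ[volume] fun x : ℝ => (x : ℂ) ^ a *
        (∑ n ∈ Finset.range N, c n • numberL2 n : Lp ℂ 2 (volume : Measure ℝ)) x := by
    intro N
    induction N with
    | zero =>
      simp only [Finset.range_zero, Finset.sum_empty]
      exact Eventually.of_forall fun x => by simp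
    | succ N ih =>
      simp only [Finset.sum_range_succ]
      filter_upwards [ih,
        Lp.coeFn_add (∑ n ∈ Finset.range N, c n • powNumberL2 a n) (c N • powNumberL2 a N),
        Lp.coeFn_add (∑ n ∈ Finset.range N, c n • numberL2 n) (c N • numberL2 N),
        Lp.coeFn_smul (c N) (powNumberL2 a N), Lp.coeFn_smul (c N) (numberL2 N),
        coeFn_powNumberL2 a N, coeFn_numberL2 N] with x e1 e2 e3 e4 e5 e6 e7
      rw [e2, e3, Pi.add_apply, Pi.add_apply, e1, e4, e5, Pi.smul_apply, Pi.smul_apply, e6, e7]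
      push_cast
      simp only [smul_eq_mul]; ring
  filter_upwards [h3, h4, ae_all_iff.2 h5] with x e3 e4 e5
  refine tendsto_nhds_unique (e3.comp hms.tendsto_atTop) ?_
  refine (e4.const_mul ((x : ℂ) ^ a)).congr fun i => ?_
  simp only [Function.comp_apply]
  exact (e5 _).symm

theorem measurable_enorm_quadratureRep (φ : ℝ) (ψ : Fock) :
    Measurable fun x => ‖quadratureRep φ ψ x‖ₑ ^ 2 :=
  (Lp.stronglyMeasurable _).measurable.enorm.pow_const 2

/-- Splitting the exponent as `a + b` writes the moment as an inner product of two convergent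
series, and reaches odd exponents as well. -/
theorem integrable_pow_vecOutcome {ψ : Fock} {a b : ℕ} (ha : vecMoment ψ a ≠ ⊤)
    (hb : vecMoment ψ b ≠ ⊤) (φ : ℝ) :
    Integrable (fun x : ℝ => (x : ℂ) ^ (a + b)) (vecOutcome ψ φ) ∧
    ∫ x : ℝ, (x : ℂ) ^ (a + b) ∂(vecOutcome ψ φ) =
      inner ℂ (∑' n : ℕ, (ψ n * phaseExp (-n) φ) • powNumberL2 a n)
        (∑' n : ℕ, (ψ n * phaseExp (-n) φ) • powNumberL2 b n) := by
  set S := (∑' n : ℕ, (ψ n * phaseExp (-n) φ) • powNumberL2 a n : Lp ℂ 2 (volume : Measure ℝ))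
  set T := (∑' n : ℕ, (ψ n * phaseExp (-n) φ) • powNumberL2 b n : Lp ℂ 2 (volume : Measure ℝ))
  have hm := measurable_enorm_quadratureRep φ ψ
  have hfin : ∀ᵐ x, ‖quadratureRep φ ψ x‖ₑ ^ 2 < ⊤ :=
    Eventually.of_forall fun x => ENNReal.pow_lt_top enorm_lt_top
  have he : (fun x => inner ℂ (S x) (T x)) =ᵐ[volume]
      fun x : ℝ => (‖quadratureRep φ ψ x‖ₑ ^ 2).toReal • (x : ℂ) ^ (a + b) := by
    filter_upwards [coeFn_pow_quadratureRep ha φ, coeFn_pow_quadratureRep hb φ] with x h1 h2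
    rw [h1, h2, RCLike.inner_apply, map_mul, map_pow, Complex.conj_ofReal, ENNReal.toReal_pow,
      toReal_enorm, Complex.real_smul]
    push_cast
    rw [← Complex.mul_conj']
    ring
  constructor
  · rw [vecOutcome, integrable_withDensity_iff_integrable_smul' hm hfin]
    exact (L2.integrable_inner S T).congr he
  · rw [vecOutcome, integral_withDensity_eq_integral_toReal_smul hm hfin, L2.inner_def]
    exact (integral_congr_ae he).symm

/-- For truncated series the inner product is a finite combination of `e^{i(n-m)φ}` weighted by
matrix elements, whose band structure allows exactly the frequencies of `trigSpan`. The space is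
closed under the pointwise limit. -/
theorem integral_pow_vecOutcome_mem_trigSpan {ψ : Fock} {a b : ℕ} (ha : vecMoment ψ a ≠ ⊤)
    (hb : vecMoment ψ b ≠ ⊤) :
    (fun φ => ∫ x : ℝ, (x : ℂ) ^ (a + b) ∂(vecOutcome ψ φ)) ∈ trigSpan (a + b) := by
  refine (isClosed_trigSpan (a + b)).mem_of_tendsto (b := atTop)
    (f := fun (N : ℕ) φ => inner ℂ
      (∑ n ∈ Finset.range N, (ψ n * phaseExp (-n) φ) • powNumberL2 a n)
      (∑ n ∈ Finset.range N, (ψ n * phaseExp (-n) φ) • powNumberL2 b n)) ?_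
      (Eventually.of_forall fun N => ?_)
  · rw [tendsto_pi_nhds]
    intro φ
    rw [(integrable_pow_vecOutcome ha hb φ).2]
    exact (summable_pow_quadratureRep ha φ).hasSum.tendsto_sum_nat.inner
      (summable_pow_quadratureRep hb φ).hasSum.tendsto_sum_nat
  · have h1 : (fun φ => inner ℂ
        (∑ n ∈ Finset.range N, (ψ n * phaseExp (-n) φ) • powNumberL2 a n)
        (∑ n ∈ Finset.range N, (ψ n * phaseExp (-n) φ) • powNumberL2 b n)) =
        ∑ m ∈ Finset.range N, ∑ n ∈ Finset.range N,
          (starRingEnd ℂ (ψ n) * ψ m * matrixElement (a + b) n m) • phaseExp (n - m) := by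
      ext φ
      simp only [sum_inner, inner_sum, inner_smul_left, inner_smul_right, map_mul, conj_phaseExp,
        inner_powNumberL2, Finset.sum_apply, Pi.smul_apply, smul_eq_mul, Finset.mul_sum]
      refine Finset.sum_congr rfl fun m _ => Finset.sum_congr rfl fun n _ => ?_
      have : phaseExp (n - m) φ = phaseExp (- -n) φ * phaseExp (-m) φ := by
        rw [phaseExp_mul]; congr 1; ring
      rw [this]; ring
    rw [h1]
    refine Submodule.sum_mem _ fun m _ => Submodule.sum_mem _ fun n _ => ?_
    by_cases h : matrixElement (a + b) n m = 0
    · rw [h]; simp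
    · obtain ⟨h2, h3⟩ := band_of_matrixElement_ne_zero h
      exact Submodule.smul_mem _ _ (phaseExp_mem_trigSpan h2 h3)

/-- An even moment is a nonnegative trigonometric polynomial of degree at most `2k`, so its `L¹`
norm is the averaged moment itself. At `θ = 0` this controls the delta estimator. -/
theorem lintegral_pow_vecOutcome_le (ψ : Fock) (k : ℕ) (θ : ℝ) :
    ∫⁻ x, ‖x‖ₑ ^ (2 * k) ∂(vecOutcome ψ θ) ≤ (2 * k + 1) * vecMoment ψ k := by
  by_cases h : vecMoment ψ k = ⊤
  · rw [h, ENNReal.mul_top (by simp)]; exact le_top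
  set g : ℝ → ℂ := fun φ => ∫ x : ℝ, (x : ℂ) ^ (k + k) ∂(vecOutcome ψ φ) with hg
  have hmem : g ∈ trigSpan (k + k) := integral_pow_vecOutcome_mem_trigSpan h h
  have h1 : ∀ φ, ‖g φ‖ₑ = ∫⁻ x, ‖x‖ₑ ^ (2 * k) ∂(vecOutcome ψ φ) := by
    intro φ
    have hi := (integrable_pow_vecOutcome h h φ).1
    -- The exponent is even, so the integrand equals its own norm.
    have h2 : g φ = ((∫ x, ‖(x : ℂ) ^ (k + k)‖ ∂(vecOutcome ψ φ) : ℝ) : ℂ) := by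
      rw [← integral_complex_ofReal]
      refine integral_congr_ae (Eventually.of_forall fun x => ?_)
      simp [← two_mul, pow_mul]
    rw [h2, ← ofReal_norm, Complex.norm_real, Real.norm_of_nonneg (by positivity),
      ofReal_integral_norm_eq_lintegral_enorm hi]
    refine lintegral_congr fun x => ?_
    rw [enorm_pow, two_mul]
    congr 1
    simp [enorm_eq_nnnorm]
  have h2 := norm_le_of_mem_trigSpan hmem θ
  rw [← h1 θ, ← ofReal_norm]
  refine (ENNReal.ofReal_le_ofReal h2).trans (le_of_eq ?_)
  rw [ENNReal.ofReal_mul (by positivity), ofReal_integral_norm_eq_lintegral_enorm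
    (integrable_phaseMeasure_of_continuous (continuous_of_mem_trigSpan hmem))]
  simp_rw [h1]
  rw [vecMoment]
  congr 1
  rw [← two_mul, ENNReal.ofReal_add (by positivity) (by norm_num)]
  simp

/-! ### Moments of a state -/

theorem lintegral_outcome (ρ : State) (φ : ℝ) (f : ℝ → ℝ≥0∞) :
    ∫⁻ x, f x ∂(ρ.outcome φ) = ∑' j, ∫⁻ x, f x ∂(vecOutcome (ρ.vec j) φ) := by
  rw [outcome_eq_sum, lintegral_sum_measure]

theorem meanMoment_eq_tsum (ρ : State) (k : ℕ) :
    ρ.meanMoment k = ∑' j, vecMoment (ρ.vec j) k := by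
  simp only [State.meanMoment, vecMoment, lintegral_outcome]
  refine lintegral_tsum fun j => ?_
  exact ((Measure.measurable_lintegral (by fun_prop)).comp (measurable_vecOutcome _)).aemeasurable

theorem lintegral_pow_outcome_le (ρ : State) (k : ℕ) (θ : ℝ) :
    ∫⁻ x, ‖x‖ₑ ^ (2 * k) ∂(ρ.outcome θ) ≤ (2 * k + 1) * ρ.meanMoment k := by
  rw [lintegral_outcome, meanMoment_eq_tsum, ← ENNReal.tsum_mul_left]
  exact ENNReal.tsum_le_tsum fun j => lintegral_pow_vecOutcome_le _ _ _

theorem lintegral_pow_outcome_le_one_add (ρ : State) {m l : ℕ} (h : m ≤ l) (φ : ℝ) :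
    ∫⁻ x, ‖x‖ₑ ^ m ∂(ρ.outcome φ) ≤ 1 + ∫⁻ x, ‖x‖ₑ ^ l ∂(ρ.outcome φ) := by
  refine (lintegral_mono fun x => enorm_pow_le_one_add h x).trans (le_of_eq ?_)
  rw [lintegral_add_left (by fun_prop)]
  simp

theorem enorm_ofReal_pow (x : ℝ) (m : ℕ) : ‖(x : ℂ) ^ m‖ₑ = ‖x‖ₑ ^ m := by
  rw [enorm_pow]; congr 1; simp [enorm_eq_nnnorm]

theorem integrable_pow_outcome {ρ : State} {m k : ℕ} (hm : m ≤ 2 * k) (h : ρ.meanMoment k ≠ ⊤)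
    (φ : ℝ) : Integrable (fun x : ℝ => (x : ℂ) ^ m) (ρ.outcome φ) := by
  refine ⟨(by fun_prop : Continuous fun x : ℝ => (x : ℂ) ^ m).aestronglyMeasurable, ?_⟩
  rw [HasFiniteIntegral]
  simp_rw [enorm_ofReal_pow]
  refine (lintegral_pow_outcome_le_one_add ρ hm φ).trans_lt (ENNReal.add_lt_top.2 ⟨by simp, ?_⟩)
  refine (lintegral_pow_outcome_le ρ k φ).trans_lt (ENNReal.mul_lt_top ?_ h.lt_top)
  exact ENNReal.add_lt_top.2 ⟨ENNReal.mul_lt_top (by simp) (by simp), by simp⟩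

/-- The sum over the ensemble is a second pointwise limit inside the same closed space. -/
theorem integral_pow_outcome_mem_trigSpan {ρ : State} {a b k : ℕ} (ha : a ≤ k) (hb : b ≤ k)
    (h : ρ.meanMoment k ≠ ⊤) :
    (fun φ => ∫ x : ℝ, (x : ℂ) ^ (a + b) ∂(ρ.outcome φ)) ∈ trigSpan (a + b) := by
  have hj : ∀ j, vecMoment (ρ.vec j) k ≠ ⊤ := by
    rw [meanMoment_eq_tsum] at h
    exact ENNReal.ne_top_of_tsum_ne_top h
  refine (isClosed_trigSpan (a + b)).mem_of_tendsto (b := atTop)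
    (f := fun (N : ℕ) => ∑ j ∈ Finset.range N,
      fun φ => ∫ x : ℝ, (x : ℂ) ^ (a + b) ∂(vecOutcome (ρ.vec j) φ)) ?_
      (Eventually.of_forall fun N => Submodule.sum_mem _ fun j _ =>
        integral_pow_vecOutcome_mem_trigSpan (vecMoment_ne_top_of_le ha (hj j))
          (vecMoment_ne_top_of_le hb (hj j)))
  rw [tendsto_pi_nhds]
  intro φ
  have hi := integrable_pow_outcome (m := a + b) (by omega) h φ
  rw [outcome_eq_sum] at hi ⊢
  simpa using (hasSum_integral_measure hi).tendsto_sum_nat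

/-! ### Estimators that are power series in the outcome -/

/-- Fubini and termwise integration on the product of phases and outcomes. The phase measure is left
general so that the point mass, the ordinary estimator and the Poisson form are all covered; the
expansion is required only for almost every phase because the closed forms are singular at `φ = 0`.
-/
theorem converges_and_hasSum_mean (w : Measure ℝ) [SFinite w] (ρ : State) {t : ℕ → ℝ → ℂ}
    {B : ℕ → ℝ≥0∞} {m : ℕ → ℕ} {n : ℝ → ℝ → ℂ} (ht : ∀ k, Measurable (t k))
    (hB : ∀ k φ, ‖t k φ‖ₑ ≤ B k)
    (hS : ∑' k, B k * ∫⁻ φ, ∫⁻ x, ‖x‖ₑ ^ m k ∂(ρ.outcome φ) ∂w ≠ ⊤)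
    (hn : ∀ᵐ φ ∂w, ∀ x : ℝ, HasSum (fun k => t k φ * (x : ℂ) ^ m k) (n φ x)) :
    Estimator.Converges ⟨w, n⟩ ρ ∧
    HasSum (fun k => ∫ φ, t k φ * ∫ x : ℝ, (x : ℂ) ^ m k ∂(ρ.outcome φ) ∂w)
      (Estimator.mean ⟨w, n⟩ ρ) := by
  let h : ℕ → ℝ × ℝ → ℂ := fun k p => t k p.1 * (p.2 : ℂ) ^ m k
  -- No joint measurability of `n` is assumed; `H` is a measurable function that agrees with it for
  -- almost every phase.
  let H : ℝ × ℝ → ℂ := fun p => ∑' k, h k p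
  have hm : ∀ k, Measurable (h k) := fun k => by
    have := ht k
    fun_prop
  have hH : Measurable H := Measurable.tsum hm
  have hk : ∀ k, ∫⁻ p, ‖h k p‖ₑ ∂(w.compProd ρ.kernel) ≤
      B k * ∫⁻ φ, ∫⁻ x, ‖x‖ₑ ^ m k ∂(ρ.outcome φ) ∂w := by
    intro k
    have hmm : Measurable fun φ => ∫⁻ x, ‖x‖ₑ ^ m k ∂(ρ.outcome φ) :=
      (Measure.measurable_lintegral (by fun_prop)).comp (measurable_outcome ρ)
    rw [Measure.lintegral_compProd (hm k).enorm, ← lintegral_const_mul _ hmm]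
    refine lintegral_mono fun φ => ?_
    rw [ρ.kernel_apply, ← lintegral_const_mul _ (by fun_prop)]
    refine lintegral_mono fun x => ?_
    simp only [h, enorm_mul, enorm_ofReal_pow]
    gcongr
    exact hB k φ
  have hsum : ∑' k, ∫⁻ p, ‖h k p‖ₑ ∂(w.compProd ρ.kernel) ≠ ⊤ :=
    ne_top_of_le_ne_top hS (ENNReal.tsum_le_tsum hk)
  have hki : ∀ k, Integrable (h k) (w.compProd ρ.kernel) := fun k =>
    ⟨(hm k).aestronglyMeasurable, (ENNReal.ne_top_of_tsum_ne_top hsum k).lt_top⟩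
  have hHi : Integrable H (w.compProd ρ.kernel) := by
    refine ⟨hH.aestronglyMeasurable, lt_of_le_of_lt ?_ hsum.lt_top⟩
    rw [← lintegral_tsum fun k => (hm k).enorm.aemeasurable]
    exact lintegral_mono fun p => enorm_tsum_le_tsum_enorm
  have hs : HasSum (fun k => ∫ p, h k p ∂(w.compProd ρ.kernel)) (∫ p, H p ∂(w.compProd ρ.kernel)) := by
    refine hasSum_integral_of_summable_integral_norm hki ?_
    refine (ENNReal.summable_toReal hsum).congr fun k => ?_
    rw [integral_norm_eq_lintegral_enorm (hm k).aestronglyMeasurable]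
  have hnH : ∀ᵐ φ ∂w, n φ = fun x => H (φ, x) := by
    filter_upwards [hn] with φ hφ
    funext x
    exact (hφ x).tsum_eq.symm
  have hint : (fun φ => ∫ x, n φ x ∂(ρ.outcome φ)) =ᵐ[w]
      fun φ => ∫ x, H (φ, x) ∂(ρ.kernel φ) := by
    filter_upwards [hnH] with φ hφ
    rw [hφ, ρ.kernel_apply]
  refine ⟨⟨?_, ?_, ?_⟩, ?_⟩
  · filter_upwards [hnH, ((Measure.integrable_compProd_iff hH.aestronglyMeasurable).1 hHi).1]
      with φ h1 h2
    simp only [h1]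
    exact h2
  · exact hHi.integral_compProd.congr hint.symm
  · have : ∫⁻ φ, ∫⁻ x, ‖n φ x‖ₑ ∂(ρ.outcome φ) ∂w = ∫⁻ p, ‖H p‖ₑ ∂(w.compProd ρ.kernel) := by
      rw [Measure.lintegral_compProd hH.enorm]
      refine lintegral_congr_ae ?_
      filter_upwards [hnH] with φ hφ
      rw [hφ, ρ.kernel_apply]
    simp only [this]
    exact hHi.2
  · have h1 : Estimator.mean ⟨w, n⟩ ρ = ∫ p, H p ∂(w.compProd ρ.kernel) := by
      rw [Measure.integral_compProd hHi]
      exact integral_congr_ae hint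
    rw [h1]
    refine hs.congr_fun fun k => ?_
    rw [Measure.integral_compProd (hki k)]
    simp only [h, integral_const_mul, ρ.kernel_apply]

/-! ### Closed form of the Dirichlet kernel -/

theorem phaseExp_two_ne_one {φ : ℝ} (h : φ ∈ Set.Ioo 0 Real.pi) : phaseExp 2 φ ≠ 1 := by
  intro h1
  rw [phaseExp, Complex.exp_eq_one_iff] at h1
  obtain ⟨n, hn⟩ := h1
  have h2 : φ = n * Real.pi := by
    have h3 : ((2 : ℤ) * φ : ℂ) = n * (2 * Real.pi) :=
      mul_right_cancel₀ Complex.I_ne_zero (by rw [hn]; ring)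
    have h4 : (φ : ℂ) = (n * Real.pi : ℝ) := by push_cast at h3 ⊢; linear_combination h3 / 2
    exact_mod_cast h4
  have h5 : 0 < (n : ℝ) := by
    by_contra h6
    have := mul_nonpos_of_nonpos_of_nonneg (not_lt.1 h6) Real.pi_pos.le
    linarith [h.1]
  have h6 : (n : ℝ) < 1 := by
    by_contra h7
    have := mul_le_mul_of_nonneg_right (not_lt.1 h7) Real.pi_pos.le
    linarith [h.2]
  have h7 : 0 < n := by exact_mod_cast h5
  have h8 : n < 1 := by exact_mod_cast h6
  omega

theorem phaseExp_neg_mul_self (n : ℤ) (φ : ℝ) : phaseExp (-n) φ * phaseExp n φ = 1 := by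
  rw [phaseExp_mul]; simp

/-- A geometric sum of ratio `e^{2iφ}`, which differs from `1` inside the open interval; its two
boundary terms are the two fractions. -/
theorem dirichletKernel_eq_div {φ : ℝ} (h : φ ∈ Set.Ioo 0 Real.pi) (m : ℕ) :
    dirichletKernel m φ = phaseExp m φ / (1 - phaseExp (-2) φ) +
      phaseExp (-m) φ / (1 - phaseExp 2 φ) := by
  have h1 := phaseExp_two_ne_one h
  have h2 : dirichletKernel m φ = phaseExp (-m) φ * ∑ i ∈ Finset.range (m + 1), phaseExp 2 φ ^ i := by
    rw [dirichletKernel, Finset.mul_sum, ← Fin.sum_univ_eq_sum_range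
      (fun i => phaseExp (-m) φ * phaseExp 2 φ ^ i)]
    refine Finset.sum_congr rfl fun i _ => ?_
    rw [phaseExp_pow, phaseExp_mul]; congr 1; ring
  have h3 : phaseExp m φ = phaseExp (-m) φ * phaseExp 2 φ ^ m := by
    rw [phaseExp_pow, phaseExp_mul]; congr 1; ring
  have h4 : phaseExp (-2) φ = (phaseExp 2 φ)⁻¹ :=
    eq_inv_of_mul_eq_one_left (phaseExp_neg_mul_self 2 φ)
  have h5 : phaseExp 2 φ ≠ 0 := Complex.exp_ne_zero _
  rw [h2, geom_sum_eq h1, h3, h4]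
  generalize phaseExp 2 φ = q at *
  have h6 : q - 1 ≠ 0 := sub_ne_zero.2 h1
  have h7 : 1 - q ≠ 0 := sub_ne_zero.2 h1.symm
  have h8 : 1 - q⁻¹ = (q - 1) / q := by field_simp
  have h9 : 1 - q = -(q - 1) := by ring
  rw [h8, h9]
  field_simp
  ring

/-! ### The Poisson identities for power series in the outcome -/

theorem enorm_dirichletKernel_le (m : ℕ) (φ : ℝ) : ‖dirichletKernel m φ‖ₑ ≤ (m : ℝ≥0∞) + 1 := by
  rw [← ofReal_norm]
  refine (ENNReal.ofReal_le_ofReal (norm_dirichletKernel_le m φ)).trans (le_of_eq ?_)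
  rw [ENNReal.ofReal_add (by positivity) (by norm_num)]
  simp

/-- The phase averaged absolute moment `∫ dφ/π ⟨|X_φ|^m⟩`. -/
def State.absMoment (ρ : State) (m : ℕ) : ℝ≥0∞ :=
  ∫⁻ φ, ∫⁻ x, ‖x‖ₑ ^ m ∂(ρ.outcome φ) ∂phaseMeasure

/-- The moment `⟨X_φ^m⟩`. -/
def State.moment (ρ : State) (m : ℕ) (φ : ℝ) : ℂ := ∫ x : ℝ, (x : ℂ) ^ m ∂(ρ.outcome φ)

theorem lintegral_enorm_moment_le (ρ : State) (m : ℕ) :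
    ∫⁻ φ, ‖ρ.moment m φ‖ₑ ∂phaseMeasure ≤ ρ.absMoment m := by
  refine lintegral_mono fun φ => (enorm_integral_le_lintegral_enorm _).trans ?_
  simp_rw [enorm_ofReal_pow]
  exact le_rfl

theorem integral_norm_moment_le {ρ : State} {m : ℕ} (hc : Continuous (ρ.moment m))
    (h : ρ.absMoment m ≠ ⊤) : ∫ φ, ‖ρ.moment m φ‖ ∂phaseMeasure ≤ (ρ.absMoment m).toReal := by
  rw [integral_norm_eq_lintegral_enorm hc.aestronglyMeasurable]
  exact ENNReal.toReal_mono h (lintegral_enorm_moment_le ρ m)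

section PowerSeries

variable {ρ : State} {s : ℕ} {a : ℕ → ℂ} {F : ℝ → ℂ} {E : ℝ → ℝ → ℂ}

theorem delta_converges_and_hasSum
    (h0 : ∑' k, ‖a k‖ₑ * ∫⁻ x, ‖x‖ₑ ^ (2 * k + s) ∂(ρ.outcome 0) ≠ ⊤)
    (hF : ∀ x : ℝ, HasSum (fun k => a k * (x : ℂ) ^ (2 * k + s)) (F x)) :
    (Estimator.mulDelta fun _ x => F x).Converges ρ ∧
    HasSum (fun k => (1 / Real.pi : ℂ) * a k * ρ.moment (2 * k + s) 0)
      ((Estimator.mulDelta fun _ x => F x).mean ρ) := by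
  have h := converges_and_hasSum_mean (ENNReal.ofReal (1 / Real.pi) • Measure.dirac (0 : ℝ)) ρ
    (t := fun k _ => a k) (B := fun k => ‖a k‖ₑ) (m := fun k => 2 * k + s) (n := fun _ x => F x)
    (fun k => measurable_const) (fun k φ => le_rfl) ?_ (Eventually.of_forall fun _ => hF)
  · refine ⟨h.1, h.2.congr_fun fun k => ?_⟩
    rw [integral_smul_measure, integral_dirac, ENNReal.toReal_ofReal (by positivity),
      Complex.real_smul, State.moment]
    push_cast
    ring
  · simp_rw [lintegral_smul_measure, lintegral_dirac, smul_eq_mul,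
      mul_left_comm _ (ENNReal.ofReal (1 / Real.pi)), ENNReal.tsum_mul_left]
    exact ENNReal.mul_ne_top ENNReal.ofReal_ne_top h0

/-- The weight `2k + s + 1` in `hL` is the uniform bound of the Dirichlet kernel, and the kernel
turns each averaged moment into its value at `0`. Membership is asked only where `a k ≠ 0`:
elsewhere the moment may be infinite without affecting `hL`. -/
theorem ofFun_converges_and_hasSum
    (hmem : ∀ k, a k ≠ 0 → ρ.moment (2 * k + s) ∈ trigSpan (2 * k + s))
    (hL : ∑' k, (((2 * k + s : ℕ) : ℝ≥0∞) + 1) * ‖a k‖ₑ * ρ.absMoment (2 * k + s) ≠ ⊤)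
    (hE : ∀ φ ∈ Set.Ioo 0 Real.pi, ∀ x : ℝ, HasSum (fun k => (1 / Real.pi : ℂ) * a k *
      dirichletKernel (2 * k + s) φ * (x : ℂ) ^ (2 * k + s)) (E φ x)) :
    (Estimator.ofFun E).Converges ρ ∧
    HasSum (fun k => (1 / Real.pi : ℂ) * a k * ρ.moment (2 * k + s) 0)
      ((Estimator.ofFun E).mean ρ) := by
  have h := converges_and_hasSum_mean phaseMeasure ρ
    (t := fun k φ => (1 / Real.pi : ℂ) * a k * dirichletKernel (2 * k + s) φ)
    (B := fun k => ‖(1 / Real.pi : ℂ)‖ₑ * ((((2 * k + s : ℕ) : ℝ≥0∞) + 1) * ‖a k‖ₑ))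
    (m := fun k => 2 * k + s) (n := E) (fun k => by fun_prop) (fun k φ => ?_) ?_ ?_
  · refine ⟨h.1, h.2.congr_fun fun k => ?_⟩
    by_cases hk : a k = 0
    · simp [hk]
    · simp_rw [mul_assoc ((1 / Real.pi : ℂ) * a k)]
      rw [integral_const_mul]
      have := integral_dirichletKernel_mul (hmem k hk)
      simp only [State.moment] at this ⊢
      rw [this]
  · rw [enorm_mul, enorm_mul, mul_comm (_ + 1), ← mul_assoc]
    gcongr
    exact enorm_dirichletKernel_le _ _
  · simp_rw [mul_assoc ‖(1 / Real.pi : ℂ)‖ₑ, ENNReal.tsum_mul_left]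
    exact ENNReal.mul_ne_top enorm_ne_top hL
  · filter_upwards [ae_phaseMeasure_Ioo] with φ hφ
    exact hE φ hφ

theorem poissonDelta_converges_and_hasSum
    (hL : ∑' k, (((2 * k + s : ℕ) : ℝ≥0∞) + 1) * ‖a k‖ₑ * ρ.absMoment (2 * k + s) ≠ ⊤)
    (hF : ∀ x : ℝ, HasSum (fun k => a k * (x : ℂ) ^ (2 * k + s)) (F x)) {ε : ℝ} (hε0 : 0 ≤ ε)
    (hε1 : ε < 1) :
    (Estimator.ofFun fun φ x => F x * phaseExp s φ * poissonDelta ε φ).Converges ρ ∧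
    HasSum (fun k => (1 / Real.pi : ℂ) * a k *
      ∫ φ, phaseExp s φ * poissonKernel ε φ * ρ.moment (2 * k + s) φ ∂phaseMeasure)
      ((Estimator.ofFun fun φ x => F x * phaseExp s φ * poissonDelta ε φ).mean ρ) := by
  have hc := continuous_poissonKernel hε0 hε1
  -- This bound of the kernel blows up as `ε → 1`, which is harmless for convergence at fixed `ε`.
  set C : ℝ := ∑' n : ℤ, ε ^ n.natAbs
  have h := converges_and_hasSum_mean phaseMeasure ρ
    (t := fun k φ => (1 / Real.pi : ℂ) * a k * (phaseExp s φ * poissonKernel ε φ))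
    (B := fun k => ‖(1 / Real.pi : ℂ)‖ₑ * ENNReal.ofReal C * ‖a k‖ₑ)
    (m := fun k => 2 * k + s) (n := fun φ x => F x * phaseExp s φ * poissonDelta ε φ)
    (fun k => Continuous.measurable (by fun_prop)) (fun k φ => ?_) ?_ ?_
  · refine ⟨h.1, h.2.congr_fun fun k => ?_⟩
    simp_rw [mul_assoc ((1 / Real.pi : ℂ) * a k)]
    rw [integral_const_mul]
    rfl
  · rw [enorm_mul, enorm_mul, mul_right_comm]
    gcongr
    rw [← ofReal_norm]
    refine ENNReal.ofReal_le_ofReal ?_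
    rw [norm_mul, norm_phaseExp, one_mul]
    exact norm_poissonKernel_le hε0 hε1 φ
  · simp_rw [mul_assoc (‖(1 / Real.pi : ℂ)‖ₑ * ENNReal.ofReal C), ENNReal.tsum_mul_left]
    refine ENNReal.mul_ne_top (ENNReal.mul_ne_top enorm_ne_top ENNReal.ofReal_ne_top) ?_
    refine ne_top_of_le_ne_top hL (ENNReal.tsum_le_tsum fun k => ?_)
    rw [mul_assoc]
    exact le_mul_of_one_le_left' le_add_self
  · refine Eventually.of_forall fun φ x => ?_
    rw [poissonDelta_eq]
    have := (hF x).mul_left ((1 / Real.pi : ℂ) * (phaseExp s φ * poissonKernel ε φ))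
    rw [show F x * phaseExp s φ * ((1 / Real.pi : ℂ) * poissonKernel ε φ) =
      (1 / Real.pi : ℂ) * (phaseExp s φ * poissonKernel ε φ) * F x by ring]
    exact this.congr_fun fun k => by ring

/-- Dominated convergence for the series over `k`. The bound uniform in `ε` comes from the moments
being trigonometric polynomials, not from the size of the Poisson kernel. -/
theorem tendsto_mean_poissonDelta
    (hmem : ∀ k, a k ≠ 0 → ρ.moment (2 * k + s) ∈ trigSpan (2 * k + s))
    (hL : ∑' k, (((2 * k + s : ℕ) : ℝ≥0∞) + 1) * ‖a k‖ₑ * ρ.absMoment (2 * k + s) ≠ ⊤)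
    (hF : ∀ x : ℝ, HasSum (fun k => a k * (x : ℂ) ^ (2 * k + s)) (F x)) :
    Tendsto (fun ε =>
      (Estimator.ofFun fun φ x => F x * phaseExp s φ * poissonDelta ε φ).mean ρ) (𝓝[<] 1)
      (𝓝 (∑' k, (1 / Real.pi : ℂ) * a k * ρ.moment (2 * k + s) 0)) := by
  have hev : ∀ᶠ ε : ℝ in 𝓝[<] 1, ε ∈ Set.Ioo 0 1 := Ioo_mem_nhdsLT (by norm_num)
  have ht : Tendsto (fun ε => ∑' k, (1 / Real.pi : ℂ) * a k *
      ∫ φ, phaseExp s φ * poissonKernel ε φ * ρ.moment (2 * k + s) φ ∂phaseMeasure) (𝓝[<] 1)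
      (𝓝 (∑' k, (1 / Real.pi : ℂ) * a k * ρ.moment (2 * k + s) 0)) := by
    refine tendsto_tsum_of_dominated_convergence
      (bound := fun k => ‖(1 / Real.pi : ℂ)‖ *
        ((((2 * k + s : ℕ) : ℝ≥0∞) + 1) * ‖a k‖ₑ * ρ.absMoment (2 * k + s)).toReal) ?_ ?_ ?_
    · exact (ENNReal.summable_toReal hL).mul_left _
    · intro k
      by_cases hk : a k = 0
      · simp [hk]
      · exact (tendsto_integral_poissonKernel_mul (hmem k hk)).const_mul _
    · filter_upwards [hev] with ε hε k
      by_cases hk : a k = 0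
      · simp [hk]
      · have hfin : ρ.absMoment (2 * k + s) ≠ ⊤ := by
          intro htop
          have := ENNReal.ne_top_of_tsum_ne_top hL k
          rw [htop, ENNReal.mul_top (by simp [hk])] at this
          exact this rfl
        have h1 := (norm_integral_poissonKernel_mul_le hε.1.le hε.2 (hmem k hk)).trans
          (mul_le_mul_of_nonneg_left (integral_norm_moment_le
            (continuous_of_mem_trigSpan (hmem k hk)) hfin) (by positivity))
        have h2 : ((((2 * k + s : ℕ) : ℝ≥0∞) + 1) * ‖a k‖ₑ * ρ.absMoment (2 * k + s)).toReal =
            ‖a k‖ * (((2 * k + s : ℕ) + 1) * (ρ.absMoment (2 * k + s)).toReal) := by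
          rw [ENNReal.toReal_mul, ENNReal.toReal_mul, ENNReal.toReal_add (ENNReal.natCast_ne_top _) (by simp),
            toReal_enorm]
          simp only [ENNReal.toReal_natCast, ENNReal.toReal_one]
          ring
        rw [norm_mul, norm_mul, mul_assoc, h2]
        gcongr
  refine ht.congr' ?_
  filter_upwards [hev] with ε hε
  exact (poissonDelta_converges_and_hasSum hL hF hε.1.le hε.2).2.tsum_eq

theorem poisson_identity
    (hmem : ∀ k, a k ≠ 0 → ρ.moment (2 * k + s) ∈ trigSpan (2 * k + s))
    (hL : ∑' k, (((2 * k + s : ℕ) : ℝ≥0∞) + 1) * ‖a k‖ₑ * ρ.absMoment (2 * k + s) ≠ ⊤)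
    (h0 : ∑' k, ‖a k‖ₑ * ∫⁻ x, ‖x‖ₑ ^ (2 * k + s) ∂(ρ.outcome 0) ≠ ⊤)
    (hF : ∀ x : ℝ, HasSum (fun k => a k * (x : ℂ) ^ (2 * k + s)) (F x))
    (hE : ∀ φ ∈ Set.Ioo 0 Real.pi, ∀ x : ℝ, HasSum (fun k => (1 / Real.pi : ℂ) * a k *
      dirichletKernel (2 * k + s) φ * (x : ℂ) ^ (2 * k + s)) (E φ x)) :
    Estimator.Equiv {ρ} (Estimator.mulDelta fun _ x => F x) (Estimator.ofFun E) ∧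
    Estimator.LimEquiv {ρ}
      (fun ε => Estimator.ofFun fun φ x => F x * phaseExp s φ * poissonDelta ε φ)
      (Estimator.ofFun E) := by
  have hd := delta_converges_and_hasSum h0 hF
  have he := ofFun_converges_and_hasSum hmem hL hE
  constructor
  · rintro _ rfl
    exact ⟨hd.1, he.1, sub_eq_zero.2 (hd.2.unique he.2)⟩
  · intro ρ' hρ'
    obtain rfl : ρ' = ρ := hρ'
    refine ⟨?_, he.1, ?_⟩
    · filter_upwards [Ioo_mem_nhdsLT (show (0 : ℝ) < 1 by norm_num)] with ε hε
      exact (poissonDelta_converges_and_hasSum hL hF hε.1.le hε.2).1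
    · have := (tendsto_mean_poissonDelta hmem hL hF).sub_const ((Estimator.ofFun E).mean ρ')
      rwa [he.2.tsum_eq, sub_self] at this

end PowerSeries

/-! ### Entire functions -/

theorem hasSum_taylorCoeff {f : ℂ → ℂ} (hf : Differentiable ℂ f) (z : ℂ) :
    HasSum (fun k => taylorCoeff f k * z ^ k) (f z) := by
  refine (Complex.hasSum_taylorSeries_of_entire hf 0 z).congr_fun fun k => ?_
  simp only [taylorCoeff, smul_eq_mul, sub_zero]
  ring

/-- In the Leibniz formula only the first derivative of `z` survives at `0`. This translates the
domain of `z f(z)` into the condition `∑ (k+2) |a_k| ∫ ⟨X_φ^{2k+2}⟩ < ∞`. -/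
theorem taylorCoeff_id_mul_succ {f : ℂ → ℂ} (hf : Differentiable ℂ f) (k : ℕ) :
    taylorCoeff (fun z => z * f z) (k + 1) = taylorCoeff f k := by
  have h1 : ContDiffAt ℂ ((k + 1 : ℕ) : WithTop ℕ∞) f 0 := hf.contDiff.contDiffAt
  rw [taylorCoeff, taylorCoeff, iteratedDeriv_fun_mul contDiffAt_fun_id h1,
    Finset.sum_eq_single 1]
  · have : ((k + 1 : ℕ) : ℂ) ≠ 0 := by exact_mod_cast k.succ_ne_zero
    rw [iteratedDeriv_fun_id, Nat.factorial_succ]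
    push_cast at this ⊢
    have h2 : (k.factorial : ℂ) ≠ 0 := by exact_mod_cast k.factorial_ne_zero
    simp
    field_simp
  · intro i _ hi
    rw [iteratedDeriv_fun_id]
    simp [hi]
  · simp

/-- Needed for the odd identity, where `|x|^{2k+1} ≤ 1 + |x|^{2k+2}` leaves a part free of moments.
-/
theorem tsum_enorm_taylorCoeff_ne_top {f : ℂ → ℂ} (hf : Differentiable ℂ f) :
    ∑' k : ℕ, ((k : ℝ≥0∞) + 1) * ‖taylorCoeff f k‖ₑ ≠ ⊤ := by
  -- The point `2` is chosen because `k + 1 ≤ 2^k`.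
  have h1 := (hasSum_taylorCoeff hf 2).summable.norm
  have h2 := h1.tsum_ofReal_ne_top
  refine ne_top_of_le_ne_top h2 (ENNReal.tsum_le_tsum fun k => ?_)
  rw [norm_mul, mul_comm, ENNReal.ofReal_mul (norm_nonneg _), ofReal_norm]
  gcongr
  rw [norm_pow, ENNReal.ofReal_pow (norm_nonneg _)]
  have : k + 1 ≤ 2 ^ k := Nat.lt_two_pow_self
  simpa using (by exact_mod_cast this : ((k : ℝ≥0∞) + 1) ≤ 2 ^ k)

theorem absMoment_two_mul (ρ : State) (k : ℕ) : ρ.absMoment (2 * k) = ρ.meanMoment k := rfl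

theorem absMoment_le (ρ : State) {m k : ℕ} (h : m ≤ 2 * k) :
    ρ.absMoment m ≤ 1 + ρ.meanMoment k := by
  refine (lintegral_mono fun φ => lintegral_pow_outcome_le_one_add ρ h φ).trans (le_of_eq ?_)
  rw [lintegral_add_left (by fun_prop)]
  simp [State.meanMoment]

theorem meanMoment_ne_top_of_mem_domainOf {f : ℂ → ℂ} {ρ : State} (hρ : ρ ∈ domainOf f) {k : ℕ}
    (hk : taylorCoeff f k ≠ 0) : ρ.meanMoment k ≠ ⊤ := by
  intro htop
  have := ENNReal.ne_top_of_tsum_ne_top (LT.lt.ne hρ) k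
  rw [htop, ENNReal.mul_top (by simp [hk])] at this
  exact this rfl

/-- The right-hand side of the identity for even powers. -/
def evenEstimator (f : ℂ → ℂ) (φ x : ℝ) : ℂ := (1 / Real.pi : ℂ) *
  (f ((x : ℂ) ^ 2 * Complex.exp (2 * Complex.I * φ)) / (1 - Complex.exp (-2 * Complex.I * φ)) +
    f ((x : ℂ) ^ 2 * Complex.exp (-2 * Complex.I * φ)) / (1 - Complex.exp (2 * Complex.I * φ)))

/-- The right-hand side of the identity for odd powers. -/
def oddEstimator (f : ℂ → ℂ) (φ x : ℝ) : ℂ := (1 / Real.pi : ℂ) *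
  ((x : ℂ) * Complex.exp (Complex.I * φ) * f ((x : ℂ) ^ 2 * Complex.exp (2 * Complex.I * φ)) /
      (1 - Complex.exp (-2 * Complex.I * φ)) +
    (x : ℂ) * Complex.exp (-Complex.I * φ) * f ((x : ℂ) ^ 2 * Complex.exp (-2 * Complex.I * φ)) /
      (1 - Complex.exp (2 * Complex.I * φ)))

theorem exp_eq_phaseExp (φ : ℝ) : Complex.exp (Complex.I * φ) = phaseExp 1 φ ∧
    Complex.exp (-Complex.I * φ) = phaseExp (-1) φ ∧
    Complex.exp (2 * Complex.I * φ) = phaseExp 2 φ ∧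
    Complex.exp (-2 * Complex.I * φ) = phaseExp (-2) φ := by
  simp only [phaseExp]
  refine ⟨?_, ?_, ?_, ?_⟩ <;> · congr 1; push_cast; ring

theorem hasSum_evenEstimator {f : ℂ → ℂ} (hf : Differentiable ℂ f) {φ : ℝ}
    (hφ : φ ∈ Set.Ioo 0 Real.pi) (x : ℝ) :
    HasSum (fun k => (1 / Real.pi : ℂ) * taylorCoeff f k * dirichletKernel (2 * k + 0) φ *
      (x : ℂ) ^ (2 * k + 0)) (evenEstimator f φ x) := by
  obtain ⟨-, -, h3, h4⟩ := exp_eq_phaseExp φ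
  rw [evenEstimator, h3, h4]
  refine ((((hasSum_taylorCoeff hf _).div_const _).add
    ((hasSum_taylorCoeff hf _).div_const _)).mul_left _).congr_fun fun k => ?_
  rw [dirichletKernel_eq_div hφ, mul_pow, mul_pow, phaseExp_pow, phaseExp_pow]
  have e1 : ((2 * k + 0 : ℕ) : ℤ) = k * 2 := by push_cast; ring
  have e2 : -((k : ℤ) * 2) = k * (-2) := by ring
  rw [e1, e2]
  ring

theorem hasSum_oddEstimator {f : ℂ → ℂ} (hf : Differentiable ℂ f) {φ : ℝ}
    (hφ : φ ∈ Set.Ioo 0 Real.pi) (x : ℝ) :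
    HasSum (fun k => (1 / Real.pi : ℂ) * taylorCoeff f k * dirichletKernel (2 * k + 1) φ *
      (x : ℂ) ^ (2 * k + 1)) (oddEstimator f φ x) := by
  obtain ⟨h1, h2, h3, h4⟩ := exp_eq_phaseExp φ
  rw [oddEstimator, h1, h2, h3, h4]
  refine (((((hasSum_taylorCoeff hf _).mul_left _).div_const _).add
    (((hasSum_taylorCoeff hf _).mul_left _).div_const _)).mul_left _).congr_fun fun k => ?_
  rw [dirichletKernel_eq_div hφ, mul_pow, mul_pow, phaseExp_pow, phaseExp_pow]
  have e1 : phaseExp ((2 * k + 1 : ℕ) : ℤ) φ = phaseExp 1 φ * phaseExp (k * 2) φ := by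
    rw [phaseExp_mul]; congr 1; push_cast; ring
  have e2 : phaseExp (-((2 * k + 1 : ℕ) : ℤ)) φ = phaseExp (-1) φ * phaseExp (k * (-2)) φ := by
    rw [phaseExp_mul]; congr 1; push_cast; ring
  rw [e1, e2]
  ring

theorem even_identity {f : ℂ → ℂ} (hf : Differentiable ℂ f) {ρ : State} (hρ : ρ ∈ domainOf f) :
    Estimator.Equiv {ρ} (Estimator.mulDelta fun _ x => f ((x : ℂ) ^ 2))
      (Estimator.ofFun (evenEstimator f)) ∧
    Estimator.LimEquiv {ρ}
      (fun ε => Estimator.ofFun fun φ x => f ((x : ℂ) ^ 2) * poissonDelta ε φ)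
      (Estimator.ofFun (evenEstimator f)) := by
  -- The factor `2` absorbs `2k + 1 ≤ 2(k + 1)`, the number of frequencies against the weight of the
  -- domain.
  have hdom : ∑' k : ℕ, 2 * (((k : ℝ≥0∞) + 1) * ‖taylorCoeff f k‖ₑ * ρ.meanMoment k) ≠ ⊤ := by
    rw [ENNReal.tsum_mul_left]
    exact ENNReal.mul_ne_top (by simp) (LT.lt.ne hρ)
  have hle : ∀ k : ℕ, (2 * (k : ℝ≥0∞) + 1) ≤ 2 * ((k : ℝ≥0∞) + 1) := by
    intro k
    have : 2 * k + 1 ≤ 2 * (k + 1) := by omega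
    exact_mod_cast this
  have h := poisson_identity (ρ := ρ) (s := 0) (a := taylorCoeff f)
    (F := fun x => f ((x : ℂ) ^ 2)) (E := evenEstimator f) (fun k hk => ?_) ?_ ?_ (fun x => ?_)
    (fun φ hφ x => hasSum_evenEstimator hf hφ x)
  · simpa using h
  · rw [add_zero, two_mul]
    exact integral_pow_outcome_mem_trigSpan le_rfl le_rfl (meanMoment_ne_top_of_mem_domainOf hρ hk)
  · refine ne_top_of_le_ne_top hdom (ENNReal.tsum_le_tsum fun k => ?_)
    rw [← mul_assoc, ← mul_assoc, add_zero, absMoment_two_mul]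
    gcongr
    simpa using hle k
  · refine ne_top_of_le_ne_top hdom (ENNReal.tsum_le_tsum fun k => ?_)
    calc _ ≤ ‖taylorCoeff f k‖ₑ * ((2 * k + 1) * ρ.meanMoment k) := by
          gcongr; exact lintegral_pow_outcome_le ρ k 0
      _ ≤ ‖taylorCoeff f k‖ₑ * (2 * (k + 1) * ρ.meanMoment k) := by
          gcongr; exact hle k
      _ = _ := by ring
  · refine (hasSum_taylorCoeff hf _).congr_fun fun k => ?_
    rw [add_zero, pow_mul]

theorem odd_identity {f : ℂ → ℂ} (hf : Differentiable ℂ f) {ρ : State}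
    (hρ : ρ ∈ domainOf fun z => z * f z) :
    Estimator.Equiv {ρ} (Estimator.mulDelta fun _ x => (x : ℂ) * f ((x : ℂ) ^ 2))
      (Estimator.ofFun (oddEstimator f)) ∧
    Estimator.LimEquiv {ρ}
      (fun ε => Estimator.ofFun fun φ x =>
        (x : ℂ) * f ((x : ℂ) ^ 2) * phaseExp 1 φ * poissonDelta ε φ)
      (Estimator.ofFun (oddEstimator f)) := by
  have hdom : ∑' k : ℕ, ((k : ℝ≥0∞) + 2) * ‖taylorCoeff f k‖ₑ * ρ.meanMoment (k + 1) ≠ ⊤ := by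
    -- The series for `z f(z)` is reindexed by `k + 1`, dropping its term of index `0`.
    refine ne_top_of_le_ne_top (LT.lt.ne hρ) (le_trans (le_of_eq ?_)
      (ENNReal.tsum_comp_le_tsum_of_injective (add_left_injective 1) _))
    refine tsum_congr fun k => ?_
    simp only [taylorCoeff_id_mul_succ hf]
    push_cast
    rw [add_assoc, one_add_one_eq_two]
  have hmom : ∀ k, taylorCoeff f k ≠ 0 → ρ.meanMoment (k + 1) ≠ ⊤ := fun k hk =>
    meanMoment_ne_top_of_mem_domainOf hρ (by rwa [taylorCoeff_id_mul_succ hf])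
  -- One majorant for both sides: its first part comes from the `1` in `1 + |x|^{2k+2}`, its second
  -- from the moment of order `2k + 2`.
  have hfin : ∑' k : ℕ, (2 * (((k : ℝ≥0∞) + 1) * ‖taylorCoeff f k‖ₑ) +
      2 * (((k : ℝ≥0∞) + 2) * ‖taylorCoeff f k‖ₑ * ρ.meanMoment (k + 1))) ≠ ⊤ := by
    rw [ENNReal.tsum_add, ENNReal.tsum_mul_left, ENNReal.tsum_mul_left]
    exact ENNReal.add_ne_top.2 ⟨ENNReal.mul_ne_top (by simp) (tsum_enorm_taylorCoeff_ne_top hf),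
      ENNReal.mul_ne_top (by simp) hdom⟩
  have hle : ∀ k : ℕ, (2 * ((k : ℝ≥0∞) + 1) + 1) ≤ 2 * ((k : ℝ≥0∞) + 2) := by
    intro k
    have : 2 * (k + 1) + 1 ≤ 2 * (k + 2) := by omega
    exact_mod_cast this
  have h := poisson_identity (ρ := ρ) (s := 1) (a := taylorCoeff f)
    (F := fun x => (x : ℂ) * f ((x : ℂ) ^ 2)) (E := oddEstimator f) (fun k hk => ?_) ?_ ?_
    (fun x => ?_) (fun φ hφ x => hasSum_oddEstimator hf hφ x)
  · simpa using h
  -- The odd exponent is split as `k + (k + 1)`, so only the moment of order `2(k + 1)` has to be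
  -- finite.
  · have := integral_pow_outcome_mem_trigSpan (a := k) (b := k + 1) (by omega) le_rfl (hmom k hk)
    rw [← add_assoc, ← two_mul] at this
    exact this
  · refine ne_top_of_le_ne_top hfin (ENNReal.tsum_le_tsum fun k => ?_)
    calc _ ≤ (((2 * k + 1 : ℕ) : ℝ≥0∞) + 1) * ‖taylorCoeff f k‖ₑ * (1 + ρ.meanMoment (k + 1)) := by
          gcongr; exact absMoment_le ρ (by omega)
      _ = 2 * (((k : ℝ≥0∞) + 1) * ‖taylorCoeff f k‖ₑ) +
          2 * (((k : ℝ≥0∞) + 1) * ‖taylorCoeff f k‖ₑ * ρ.meanMoment (k + 1)) := by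
          push_cast; ring
      _ ≤ _ := by
          gcongr; norm_num
  · refine ne_top_of_le_ne_top hfin (ENNReal.tsum_le_tsum fun k => ?_)
    calc _ ≤ ‖taylorCoeff f k‖ₑ * (1 + (2 * (k + 1 : ℕ) + 1) * ρ.meanMoment (k + 1)) := by
          gcongr
          refine (lintegral_pow_outcome_le_one_add ρ (l := 2 * (k + 1)) (by omega) 0).trans ?_
          gcongr
          exact lintegral_pow_outcome_le ρ (k + 1) 0
      _ ≤ ‖taylorCoeff f k‖ₑ * (2 * (k + 1) + 2 * (k + 2) * ρ.meanMoment (k + 1)) := by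
          gcongr
          · have : 1 ≤ 2 * (k + 1) := by omega
            exact_mod_cast this
          · push_cast; exact hle k
      _ = _ := by ring
  · refine ((hasSum_taylorCoeff hf _).mul_left (x : ℂ)).congr_fun fun k => ?_
    rw [← pow_mul]
    ring

/-- Only the moment of order zero enters, and it equals `1` because the outcome measures are
probabilities. -/
theorem mem_domainOf_one (ρ : State) : ρ ∈ domainOf fun _ => 1 := by
  have h : ∀ k : ℕ, ((k : ℝ≥0∞) + 1) * ‖taylorCoeff (fun _ => 1) k‖ₑ * ρ.meanMoment k =
      if k = 0 then 1 else 0 := by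
    intro k
    by_cases hk : k = 0
    · subst hk; simp [taylorCoeff, State.meanMoment]
    · simp [taylorCoeff, iteratedDeriv_const, hk]
  simp only [domainOf, Set.mem_ofPred_eq, h, tsum_ite_eq]
  simp

/-- The estimator is `D_0 / π`, and `D_0 = 1`. The phase `0` is excluded, since division by zero
gives the value `0` there. -/
theorem evenEstimator_one {φ : ℝ} (hφ : φ ∈ Set.Ioo 0 Real.pi) (x : ℝ) :
    evenEstimator (fun _ => 1) φ x = (1 / Real.pi : ℂ) := by
  have h := dirichletKernel_eq_div hφ 0
  obtain ⟨-, -, h3, h4⟩ := exp_eq_phaseExp φ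
  simp only [dirichletKernel, Nat.cast_zero, neg_zero, phaseExp_zero_left] at h
  rw [evenEstimator, h3, h4, ← h]
  simp

/-- Allows the closed form to be replaced by the constant `1/π` despite their disagreement at `φ =
0`. -/
theorem ofFun_congr {e e' : ℝ → ℝ → ℂ} (h : ∀ φ ∈ Set.Ioo 0 Real.pi, e φ = e' φ) (ρ : State) :
    ((Estimator.ofFun e).Converges ρ ↔ (Estimator.ofFun e').Converges ρ) ∧
    (Estimator.ofFun e).mean ρ = (Estimator.ofFun e').mean ρ := by
  have hae : ∀ᵐ φ ∂phaseMeasure, e φ = e' φ := by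
    filter_upwards [ae_phaseMeasure_Ioo] with φ hφ using h φ hφ
  have hint : (fun φ => ∫ x, e φ x ∂(ρ.outcome φ)) =ᵐ[phaseMeasure]
      fun φ => ∫ x, e' φ x ∂(ρ.outcome φ) := by
    filter_upwards [hae] with φ hφ
    rw [hφ]
  have hlint : ∫⁻ φ, ∫⁻ x, ‖e φ x‖ₑ ∂(ρ.outcome φ) ∂phaseMeasure =
      ∫⁻ φ, ∫⁻ x, ‖e' φ x‖ₑ ∂(ρ.outcome φ) ∂phaseMeasure := by
    refine lintegral_congr_ae ?_
    filter_upwards [hae] with φ hφ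
    rw [hφ]
  refine ⟨and_congr ?_ (and_congr (integrable_congr hint) ?_), integral_congr_ae hint⟩
  · refine eventually_congr ?_
    filter_upwards [hae] with φ hφ
    simp only [Estimator.ofFun, hφ]
  · simp only [Estimator.ofFun, hlint]

end Homodyne

end

theorem lemma4 :
    -- the two identities, for every entire function
    (∀ f : ℂ → ℂ, Differentiable ℂ f →
      Homodyne.Estimator.Equiv (Homodyne.domainOf f)
        (Homodyne.Estimator.mulDelta fun _ x => f ((x : ℂ) ^ 2))
        (Homodyne.Estimator.ofFun fun φ x => (1 / Real.pi : ℂ) *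
          (f ((x : ℂ) ^ 2 * Complex.exp (2 * Complex.I * φ)) /
              (1 - Complex.exp (-2 * Complex.I * φ)) +
            f ((x : ℂ) ^ 2 * Complex.exp (-2 * Complex.I * φ)) /
              (1 - Complex.exp (2 * Complex.I * φ)))) ∧
      Homodyne.Estimator.Equiv (Homodyne.domainOf fun z => z * f z)
        (Homodyne.Estimator.mulDelta fun _ x => (x : ℂ) * f ((x : ℂ) ^ 2))
        (Homodyne.Estimator.ofFun fun φ x => (1 / Real.pi : ℂ) *
          ((x : ℂ) * Complex.exp (Complex.I * φ) *
              f ((x : ℂ) ^ 2 * Complex.exp (2 * Complex.I * φ)) /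
              (1 - Complex.exp (-2 * Complex.I * φ)) +
            (x : ℂ) * Complex.exp (-Complex.I * φ) *
              f ((x : ℂ) ^ 2 * Complex.exp (-2 * Complex.I * φ)) /
              (1 - Complex.exp (2 * Complex.I * φ)))) ∧
      -- the same with the delta in Poisson form (the phase factor is 1 at the delta's support)
      Homodyne.Estimator.LimEquiv (Homodyne.domainOf f)
        (fun ε => Homodyne.Estimator.ofFun fun φ x =>
          f ((x : ℂ) ^ 2) * Homodyne.poissonDelta ε φ)
        (Homodyne.Estimator.ofFun fun φ x => (1 / Real.pi : ℂ) *
          (f ((x : ℂ) ^ 2 * Complex.exp (2 * Complex.I * φ)) /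
              (1 - Complex.exp (-2 * Complex.I * φ)) +
            f ((x : ℂ) ^ 2 * Complex.exp (-2 * Complex.I * φ)) /
              (1 - Complex.exp (2 * Complex.I * φ)))) ∧
      Homodyne.Estimator.LimEquiv (Homodyne.domainOf fun z => z * f z)
        (fun ε => Homodyne.Estimator.ofFun fun φ x =>
          (x : ℂ) * f ((x : ℂ) ^ 2) * Complex.exp (Complex.I * φ) * Homodyne.poissonDelta ε φ)
        (Homodyne.Estimator.ofFun fun φ x => (1 / Real.pi : ℂ) *
          ((x : ℂ) * Complex.exp (Complex.I * φ) *
              f ((x : ℂ) ^ 2 * Complex.exp (2 * Complex.I * φ)) /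
              (1 - Complex.exp (-2 * Complex.I * φ)) +
            (x : ℂ) * Complex.exp (-Complex.I * φ) *
              f ((x : ℂ) ^ 2 * Complex.exp (-2 * Complex.I * φ)) /
              (1 - Complex.exp (2 * Complex.I * φ))))) ∧
    -- the particular case, on all states
    Homodyne.Estimator.Equiv Set.univ
      (Homodyne.Estimator.mulDelta fun _ _ => 1)
      (Homodyne.Estimator.ofFun fun _ _ => (1 / Real.pi : ℂ)) ∧
    Homodyne.Estimator.LimEquiv Set.univ
      (fun ε => Homodyne.Estimator.ofFun fun φ _ => Homodyne.poissonDelta ε φ)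
      (Homodyne.Estimator.ofFun fun _ _ => (1 / Real.pi : ℂ)) := by
  refine ⟨fun f hf => ⟨fun ρ hρ => (Homodyne.even_identity hf hρ).1 ρ rfl,
    fun ρ hρ => (Homodyne.odd_identity hf hρ).1 ρ rfl,
    fun ρ hρ => (Homodyne.even_identity hf hρ).2 ρ rfl, fun ρ hρ => ?_⟩,
    fun ρ _ => ?_, fun ρ _ => ?_⟩
  · have h := (Homodyne.odd_identity hf hρ).2 ρ rfl
    simp only [← (Homodyne.exp_eq_phaseExp _).1] at h
    exact h
  · obtain ⟨h1, h2, h3⟩ := (Homodyne.even_identity (differentiable_const 1)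
      (Homodyne.mem_domainOf_one ρ)).1 ρ rfl
    obtain ⟨h4, h5⟩ := Homodyne.ofFun_congr (e' := fun _ _ => (1 / Real.pi : ℂ))
      (fun φ hφ => funext (Homodyne.evenEstimator_one hφ)) ρ
    exact ⟨h1, h4.1 h2, by rwa [h5] at h3⟩
  · obtain ⟨h1, h2, h3⟩ := (Homodyne.even_identity (differentiable_const 1)
      (Homodyne.mem_domainOf_one ρ)).2 ρ rfl
    obtain ⟨h4, h5⟩ := Homodyne.ofFun_congr (e' := fun _ _ => (1 / Real.pi : ℂ))
      (fun φ hφ => funext (Homodyne.evenEstimator_one hφ)) ρ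
    simp only [one_mul] at h1 h3
    exact ⟨h1, h4.1 h2, by rwa [h5] at h3⟩
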